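/- All graphs are finite. For a connected plane graph $G$, the degree $\deg_G(f)$ of a face $f$ is the number of vertices incident with $f$. A cyclic coloring of $G$ is a vertex coloring in which any two different vertices incident with a common face receive different colors, and $\chi_c(G)$ is the minimum number of colors in a cyclic coloring of $G$. Let $t(G)$ denote the number of vertices of a longest path of $G$ all of whose vertices have degree $2$ in $G$ (with $t(G)=0$ if there is no vertex of degree $2$). A plane graph $G$ is a subdivision of a plane graph $R$ if it is obtained by replacing the edges of $R$, within its drawing, by paths through new vertices (possibly none); each face $f$ of $G$ then corresponds to a unique face $f'$ of $R$. **Theorem.** If $G$ is a subdivision of a simple $3$-connected plane graph $R$, then $$\chi_c(G) \le \max_{f\in F(G)}\bigl\{\deg_G(f)-\deg_R(f')\bigr\} + t(G) + \chi_c(R),$$ where $F(G)$ is the set of faces of $G$ and $f'$ is the face of $R$ corresponding to the face $f$ of $G$. Moreover, the bound is tight: for every integer $t\ge 0$ there are a simple $3$-connected plane graph $R$ and a subdivision $G$ of $R$ with $t(G)=t$ for which equality holds. -/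

import Mathlib

universe u v

/-- A connected plane graph without loops and multiple edges, given combinatorially by its rotation
system.  The permutation `rot` sends a dart (an edge directed away from one of its ends `v`) to the
next dart, in the cyclic order around `v` in the drawing, that leaves `v`.  The field `euler` says
that the surface obtained by gluing a disc to every facial walk is the sphere.  (The graph with a
single vertex and no edge has no darts; it is not covered.) -/
structure PlaneGraph (V : Type u) where
  /-- the underlying abstract graph -/
  graph : SimpleGraph V
  /-- the cyclic orders of the edges around the vertices -/
  rot : Equiv.Perm graph.Dart
  rot_fst : ∀ d, (rot d).fst = d.fst
  rot_cyclic : ∀ d e : graph.Dart, d.fst = e.fst → rot.SameCycle d e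
  connected : graph.Connected
  /-- Euler's formula, the number of faces being the number of orbits of the map that sends a dart
  to the next dart of the facial walk through it -/
  euler : (Nat.card V : ℤ) - Nat.card graph.edgeSet
    + Nat.card (Quotient (Equiv.Perm.SameCycle.setoid
        ((SimpleGraph.Dart.symm_involutive (G := graph)).toPerm.trans rot))) = 2

namespace PlaneGraph

variable {V : Type u} (G : PlaneGraph V)

/-- The successor of a dart in its facial walk: having traversed the dart from `v` to `w`,
continue with the dart that follows the reversed dart in the rotation at `w`. -/
def facePerm : Equiv.Perm G.graph.Dart :=
  (SimpleGraph.Dart.symm_involutive (G := G.graph)).toPerm.trans G.rot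

/-- The faces: the cyclic facial walks. -/
def Face : Type u := Quotient (Equiv.Perm.SameCycle.setoid G.facePerm)

/-- The face whose facial walk contains the dart `d`. -/
def faceOf (d : G.graph.Dart) : G.Face :=
  Quotient.mk (Equiv.Perm.SameCycle.setoid G.facePerm) d

variable {G} in
/-- The vertex `w` is incident with the face `f`. -/
def Incident (w : V) (f : G.Face) : Prop :=
  ∃ d : G.graph.Dart, d.fst = w ∧ G.faceOf d = f

/-- The degree of a face: the number of vertices incident with it. -/
noncomputable def faceDegree (f : G.Face) : ℕ :=
  {w : V | Incident w f}.ncard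

/-- A cyclic coloring: distinct vertices that are incident with a common face get distinct
colors. -/
def IsCyclicColoring {C : Type*} (c : V → C) : Prop :=
  ∀ (f : G.Face) (x y : V), Incident x f → Incident y f → x ≠ y → c x ≠ c y

/-- The cyclic chromatic number (of a finite plane graph). -/
noncomputable def cyclicChromaticNumber : ℕ :=
  sInf {k : ℕ | ∃ c : V → Fin k, G.IsCyclicColoring c}

/-- The number of vertices of a longest path all vertices of which have degree 2
(of a finite plane graph; it is `0` if there is no vertex of degree 2). -/
noncomputable def longestTwoPath : ℕ :=
  sSup {n : ℕ | ∃ (x y : V) (p : G.graph.Walk x y), p.IsPath ∧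
    (∀ w ∈ p.support, (G.graph.neighborSet w).ncard = 2) ∧ p.support.length = n}

/-- 3-connected: more than three vertices, and no set of fewer than three vertices separates. -/
def IsThreeConnected : Prop :=
  3 < Nat.card V ∧ ∀ S : Set V, S.ncard < 3 → (G.graph.induce Sᶜ).Connected

end PlaneGraph

/-- A presentation of the plane graph `G` as a subdivision of the plane graph `R`: every edge of `R`
is replaced by a path through new vertices, and the drawing is kept. -/
structure PlaneSubdivision {V : Type u} {W : Type v} (R : PlaneGraph V) (G : PlaneGraph W) where
  /-- the vertex of `G` that a vertex of `R` becomes -/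
  branch : V ↪ W
  /-- the path of `G` that replaces an edge of `R`, in either direction -/
  path : ∀ d : R.graph.Dart, G.graph.Walk (branch d.fst) (branch d.snd)
  path_isPath : ∀ d, (path d).IsPath
  path_symm : ∀ d, path d.symm = (path d).reverse
  /-- the inner vertices of the paths are new -/
  branch_mem_path : ∀ d x, branch x ∈ (path d).support → x = d.fst ∨ x = d.snd
  /-- paths that replace different edges have no inner vertex in common -/
  path_disjoint : ∀ d e w, w ∈ (path d).support → w ∈ (path e).support →
    d.edge ≠ e.edge → w ∈ Set.range branch
  vertex_covered : ∀ w, w ∈ Set.range branch ∨ ∃ d, w ∈ (path d).support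
  edge_covered : ∀ e ∈ G.graph.edgeSet, ∃ d, e ∈ (path d).edges
  /-- around the old vertices, the paths leave in the order of the edges that they replace -/
  rot_firstDart : ∀ d (h : ¬ (path d).Nil) (h' : ¬ (path (R.rot d)).Nil),
    G.rot ((path d).firstDart h) = (path (R.rot d)).firstDart h'

namespace PlaneSubdivision

variable {V : Type u} {W : Type v} {R : PlaneGraph V} {G : PlaneGraph W}

/-- The face `f'` of `R` corresponds to the face `f` of `G`: some edge is traversed by the facial
walk of `f'` such that the facial walk of `f` traverses a part of the path that replaces it, in the
same direction. -/
def Corresponds (S : PlaneSubdivision R G) (f : G.Face) (f' : R.Face) : Prop :=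
  ∃ d g, g ∈ (S.path d).darts ∧ R.faceOf d = f' ∧ G.faceOf g = f

theorem mem_path_symm (S : PlaneSubdivision R G) {g : G.graph.Dart} {d : R.graph.Dart} :
    g ∈ (S.path d.symm).darts ↔ g.symm ∈ (S.path d).darts := by
  have h : (S.path d.symm).darts = (S.path d).reverse.darts :=
    congrArg (fun p => SimpleGraph.Walk.darts p) (S.path_symm d)
  rw [h, SimpleGraph.Walk.mem_darts_reverse]

theorem exists_path (S : PlaneSubdivision R G) (g : G.graph.Dart) :
    ∃ d, g ∈ (S.path d).darts := by
  obtain ⟨d, hd⟩ := S.edge_covered g.edge g.edge_mem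
  obtain ⟨h, hh, he⟩ := List.mem_map.1 hd
  rcases (SimpleGraph.dart_edge_eq_iff _ _).1 he with rfl | rfl
  · exact ⟨d, hh⟩
  · refine ⟨d.symm, ?_⟩
    rwa [S.mem_path_symm]

theorem not_symm_mem {S : PlaneSubdivision R G} {g : G.graph.Dart} {d : R.graph.Dart}
    (h : g ∈ (S.path d).darts) : g.symm ∉ (S.path d).darts := by
  intro h'
  have hn := (S.path_isPath d).isTrail.edges_nodup
  have := List.inj_on_of_nodup_map hn h h' (by simp)
  exact g.symm_ne this.symm

theorem path_unique (S : PlaneSubdivision R G) {g : G.graph.Dart} {d e : R.graph.Dart}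
    (hd : g ∈ (S.path d).darts) (he : g ∈ (S.path e).darts) : d = e := by
  have h1 := SimpleGraph.Walk.dart_fst_mem_support_of_mem_darts _ hd
  have h2 := SimpleGraph.Walk.dart_snd_mem_support_of_mem_darts _ hd
  have h3 := SimpleGraph.Walk.dart_fst_mem_support_of_mem_darts _ he
  have h4 := SimpleGraph.Walk.dart_snd_mem_support_of_mem_darts _ he
  by_cases hE : d.edge = e.edge
  · rcases (SimpleGraph.dart_edge_eq_iff _ _).1 hE with h | h
    · exact h
    · subst h
      rw [S.mem_path_symm] at hd
      exact absurd hd (not_symm_mem he)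
  · exfalso
    obtain ⟨x, hx⟩ := S.path_disjoint d e _ h1 h3 hE
    obtain ⟨y, hy⟩ := S.path_disjoint d e _ h2 h4 hE
    have hxy : x ≠ y := fun h => g.fst_ne_snd (by rw [← hx, ← hy, h])
    rw [← hx] at h1 h3
    rw [← hy] at h2 h4
    apply hE
    have a1 := S.branch_mem_path _ _ h1
    have a2 := S.branch_mem_path _ _ h2
    have a3 := S.branch_mem_path _ _ h3
    have a4 := S.branch_mem_path _ _ h4
    simp only [SimpleGraph.Dart.edge, Sym2.eq_iff]
    grind

theorem not_nil (S : PlaneSubdivision R G) (d : R.graph.Dart) : ¬ (S.path d).Nil :=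
  SimpleGraph.Walk.not_nil_of_ne fun h => d.fst_ne_snd (S.branch.injective h)

theorem facePerm_mem (S : PlaneSubdivision R G) {g : G.graph.Dart} {d : R.graph.Dart}
    (hg : g ∈ (S.path d).darts) :
    G.facePerm g ∈ (S.path d).darts ∨ G.facePerm g ∈ (S.path (R.facePerm d)).darts := by
  have hp := S.path_isPath d
  obtain ⟨i, hi, rfl⟩ := List.getElem_of_mem hg
  have hi' : i < (S.path d).length := by simpa using hi
  by_cases hl : i + 1 = (S.path d).length
  · right
    have h1 : ((S.path d).darts[i]).symm = (S.path d.symm).firstDart (S.not_nil _) := by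
      have hlast : (S.path d).darts[i] = (S.path d).lastDart (S.not_nil _) := by
        rw [SimpleGraph.Walk.lastDart_eq (S.not_nil _) (by omega)]
        congr 1
        simp only [SimpleGraph.Walk.length_darts]
        omega
      rw [hlast]
      apply SimpleGraph.Dart.ext
      apply Prod.ext
      · rfl
      · have : (S.path d.symm).snd = (S.path d).penultimate := by
          rw [S.path_symm]
          exact SimpleGraph.Walk.snd_reverse _
        exact this.symm
    have h2 : G.facePerm ((S.path d).darts[i]) = G.rot ((S.path d).darts[i]).symm := rfl
    have h3 : R.facePerm d = R.rot d.symm := rfl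
    rw [h2, h1, S.rot_firstDart _ _ (S.not_nil _), h3,
      ← SimpleGraph.Walk.head_darts_eq_firstDart
        (SimpleGraph.Walk.darts_eq_nil.not.2 (S.not_nil _))]
    exact List.head_mem _
  · left
    have key : ∀ j (hj : j < (S.path d).darts.length),
        (S.path d).darts[j].fst = (S.path d).getVert j ∧
        (S.path d).darts[j].snd = (S.path d).getVert (j + 1) := by
      intro j hj
      simp [SimpleGraph.Walk.darts_getElem_eq_getVert]
    have inj : ∀ a b, a ≤ (S.path d).length → b ≤ (S.path d).length →
        (S.path d).getVert a = (S.path d).getVert b → a = b :=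
      fun a b ha hb h => hp.getVert_injOn ha hb h
    set g := (S.path d).darts[i] with hgdef
    set h := G.rot g.symm with hh
    have hfst : h.fst = (S.path d).getVert (i + 1) := by
      rw [hh, G.rot_fst]; exact (key i hi).2
    have hnb : (S.path d).getVert (i + 1) ∉ Set.range S.branch := by
      rintro ⟨x, hx⟩
      have := S.branch_mem_path d x (hx ▸ SimpleGraph.Walk.getVert_mem_support _ _)
      rcases this with rfl | rfl
      · have := inj (i + 1) 0 (by omega) (by omega) (by rw [← hx]; simp)
        omega
      · have := inj (i + 1) (S.path d).length (by omega) le_rfl (by rw [← hx]; simp)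
        omega
    have hcases : h ∈ (S.path d).darts ∨ h.symm ∈ (S.path d).darts := by
      obtain ⟨e, he⟩ := S.exists_path h
      have hE : d.edge = e.edge := by
        by_contra hE
        refine hnb (S.path_disjoint d e _ (SimpleGraph.Walk.getVert_mem_support _ _) ?_ hE)
        rw [← hfst]
        exact SimpleGraph.Walk.dart_fst_mem_support_of_mem_darts _ he
      rcases (SimpleGraph.dart_edge_eq_iff _ _).1 hE with rfl | rfl
      · exact Or.inl he
      · right
        rw [S.mem_path_symm]
        simpa using he
    rcases hcases with hc | hc
    · exact hc
    · exfalso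
      obtain ⟨j, hj, hjh⟩ := List.getElem_of_mem hc
      have hj' : j < (S.path d).length := by simpa using hj
      have e1 := (key j hj).2
      rw [hjh] at e1
      have e2 : (S.path d).getVert (i + 1) = (S.path d).getVert (j + 1) := by
        rw [← hfst, ← e1]; rfl
      have e3 := inj _ _ (by omega) (by omega) e2
      obtain rfl : i = j := by omega
      have hfix : G.rot g.symm = g.symm := by
        rw [← hh, hgdef, hjh, SimpleGraph.Dart.symm_symm]
      have hi2 : i + 1 < (S.path d).darts.length := by
        rw [SimpleGraph.Walk.length_darts]; omega
      have hs : G.rot.SameCycle g.symm (S.path d).darts[i + 1] :=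
        G.rot_cyclic _ _ (by rw [(key (i + 1) hi2).1, ← (key i hi).2]; rfl)
      have heq : g.symm = (S.path d).darts[i + 1] := by
        obtain ⟨n, hn⟩ := hs
        rw [← hn]
        exact (Function.IsFixedPt.perm_zpow hfix n).symm
      have e4 := (key (i + 1) hi2).2
      rw [← heq] at e4
      have e5 : (S.path d).getVert i = (S.path d).getVert (i + 1 + 1) := by
        rw [← e4, ← (key i hi).1]; rfl
      have := inj _ _ (by omega) (by omega) e5
      omega

/-- Every face of the subdivision corresponds to exactly one face of the original graph. -/
theorem existsUnique_corresponds (S : PlaneSubdivision R G) (f : G.Face) :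
    ∃! f', S.Corresponds f f' := by
  choose ρ hρ using S.exists_path
  have step : ∀ g, R.faceOf (ρ (G.facePerm g)) = R.faceOf (ρ g) := by
    intro g
    rcases S.facePerm_mem (hρ g) with h | h
    · rw [S.path_unique (hρ _) h]
    · rw [S.path_unique (hρ _) h]
      exact Quotient.sound ((Equiv.Perm.SameCycle.refl _ _).apply_left)
  have pow : ∀ (n : ℤ) g, R.faceOf (ρ ((G.facePerm ^ n) g)) = R.faceOf (ρ g) := by
    intro n
    induction n with
    | zero => intro g; rfl
    | succ n ih => intro g; rw [zpow_add_one, Equiv.Perm.mul_apply, ih, step]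
    | pred n ih =>
      intro g
      rw [zpow_sub_one, Equiv.Perm.mul_apply, ih, ← step (G.facePerm⁻¹ g)]
      congr 2
      exact G.facePerm.apply_symm_apply g
  obtain ⟨g, rfl⟩ : ∃ g, G.faceOf g = f := Quotient.exists_rep f
  refine ⟨R.faceOf (ρ g), ⟨_, g, hρ g, rfl, rfl⟩, ?_⟩
  rintro _ ⟨d, g', hg', rfl, hf⟩
  obtain ⟨n, hn⟩ : G.facePerm.SameCycle g g' := Quotient.exact hf.symm
  rw [S.path_unique hg' (hρ g'), ← hn, pow]

/-- The face of the original graph that corresponds to a face of the subdivision. -/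
noncomputable def origFace (S : PlaneSubdivision R G) (f : G.Face) : R.Face :=
  (S.existsUnique_corresponds f).choose

/-- The maximum of `deg_G f - deg_R f'` over the (finitely many) faces `f` of `G`, where `f'` is the
face of `R` that corresponds to `f`. -/
noncomputable def maxExcess (S : PlaneSubdivision R G) : ℤ :=
  ⨆ f : G.Face, ((G.faceDegree f : ℤ) - R.faceDegree (S.origFace f))

end PlaneSubdivision

/-! Color the old vertices by an optimal cyclic coloring of `R`, and the new vertices from a
disjoint palette. Old vertices share a face in `G` exactly when they share the corresponding face in
`R`, so only the new ones need care. A new vertex inside a replaced edge of `R` is incident with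
exactly the two faces on the sides of that edge. Regard it as an edge joining these two faces: the
new vertices become the edges of a multigraph on the faces of `R`, and coloring them cyclically
means coloring this multigraph's edges properly. Its degrees are the excesses of the faces. Since
the dual of a 3-connected plane graph is simple, parallel edges come from one edge of `R`, so there
are at most `t(G)` of them, and there are no loops. Vizing's theorem for multigraphs,
`EdgeColoring.exists_coloring`, with `Δ` the maximum excess and `μ = t(G)`, gives the bound.

Simplicity of the dual is a statement about cycles and cuts. By Euler's formula and a dimension
count modulo 2, an edge set met evenly by every facial walk is a cut
(`PlaneGraph.exists_cut_of_sum_face_eq_zero`). A loop of the dual would thus be a bridge, and two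
parallel dual edges a cut of two edges, both impossible in a 3-connected graph.

For tightness, subdivide the three edges at one vertex of `K₄` by `t` vertices each. Any two of the
`3t + 4` vertices share a face, so all need different colors, while the excess is at most `2t`,
degree-2 paths have at most `t` vertices, and `K₄` needs at most 4 colors. The graph is built from
an explicit type of darts, on which rotation and faces can be computed by cases. -/

/-! ### Vizing's theorem for multigraphs: fans and Kempe chains -/

/-- In a graph of maximum degree at most `2`, no component has three vertices of degree at most `1`. -/
theorem SimpleGraph.not_reachable_of_three_ends {X : Type*} [Fintype X] [DecidableEq X]
    (H : SimpleGraph X) [DecidableRel H.Adj] (h2 : ∀ v, H.degree v ≤ 2) {x y z : X} (hxy : x ≠ y)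
    (hxz : x ≠ z) (hyz : y ≠ z) (hx : H.degree x ≤ 1) (hy : H.degree y ≤ 1) (hz : H.degree z ≤ 1)
    (h : H.Reachable x y) : ¬ H.Reachable x z := by
  classical
  intro h'
  -- A component with `n` vertices has at least `n - 1` edges, so its degree sum is at least `2n -
  -- 2`; three ends would make it at most `2n - 3`.
  set K := H.connectedComponentMk x with hK
  have hconn := K.connected_toSimpleGraph
  have hle := hconn.card_vert_le_card_edgeSet_add_one
  have hsum := K.toSimpleGraph.sum_degrees_eq_twice_card_edges
  have hdeg : ∀ v : K, K.toSimpleGraph.degree v ≤ H.degree v.1 := by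
    intro v
    rw [← SimpleGraph.card_neighborFinset_eq_degree, ← SimpleGraph.card_neighborFinset_eq_degree]
    refine Finset.card_le_card_of_injOn Subtype.val ?_ Subtype.val_injective.injOn
    intro w hw
    simp at hw ⊢
    exact hw
  let x' : K := ⟨x, rfl⟩
  let y' : K := ⟨y, (SimpleGraph.ConnectedComponent.eq.2 h).symm⟩
  let z' : K := ⟨z, (SimpleGraph.ConnectedComponent.eq.2 h').symm⟩
  have hbound : ∀ v : K, K.toSimpleGraph.degree v + (if v ∈ ({x', y', z'} : Finset K) then 1 else 0)
      ≤ 2 := by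
    intro v
    have h1 := hdeg v
    have h2' := h2 v.1
    split_ifs with hv
    · simp only [Finset.mem_insert, Finset.mem_singleton] at hv
      rcases hv with rfl | rfl | rfl
      · have : H.degree x'.1 ≤ 1 := hx
        omega
      · have : H.degree y'.1 ≤ 1 := hy
        omega
      · have : H.degree z'.1 ≤ 1 := hz
        omega
    · omega
  have hS := Finset.sum_le_sum (fun v (_ : v ∈ Finset.univ) => hbound v)
  rw [Finset.sum_add_distrib, Finset.sum_const, smul_eq_mul, hsum, Finset.sum_ite_mem,
    Finset.univ_inter, Finset.sum_const, smul_eq_mul] at hS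
  have hc3 : ({x', y', z'} : Finset K).card = 3 :=
    Finset.card_eq_three.2 ⟨x', y', z', fun h => hxy (congrArg Subtype.val h),
      fun h => hxz (congrArg Subtype.val h), fun h => hyz (congrArg Subtype.val h), rfl⟩
  rw [Nat.card_eq_fintype_card, Nat.card_eq_fintype_card, ← SimpleGraph.edgeFinset_card] at hle
  rw [hc3, Finset.card_univ] at hS
  omega


namespace EdgeColoring

variable {E X C : Type*}

/-- The coloring `c` is proper on the set `D` of edges of the multigraph with ends `ends`. -/
def Proper (ends : E → Sym2 X) (D : Finset E) (c : E → C) : Prop :=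
  ∀ e ∈ D, ∀ e' ∈ D, e ≠ e' → ∀ v, v ∈ ends e → v ∈ ends e' → c e ≠ c e'

/-- No edge of `D` at the vertex `v` has the color `a`. -/
def Missing (ends : E → Sym2 X) (D : Finset E) (c : E → C) (v : X) (a : C) : Prop :=
  ∀ e ∈ D, v ∈ ends e → c e ≠ a

/-- The edges `s 0, …, s n` join `x` to `y 0, …, y n`, and the color of each of them but the first
is missing at the far end of the previous one. -/
structure IsFan (ends : E → Sym2 X) (D : Finset E) (c : E → C) (x : X) (e₀ : E) (n : ℕ)
    (s : ℕ → E) (y : ℕ → X) : Prop where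
  zero : s 0 = e₀
  ends_eq : ∀ i ≤ n, ends (s i) = s(x, y i)
  mem : ∀ i < n, s (i + 1) ∈ D
  missing : ∀ i < n, Missing ends D c (y i) (c (s (i + 1)))

variable {ends : E → Sym2 X} {D : Finset E} {c : E → C} {x : X} {e₀ : E} {s : ℕ → E} {y : ℕ → X}

theorem IsFan.mono {m n : ℕ} (h : IsFan ends D c x e₀ n s y) (hm : m ≤ n) :
    IsFan ends D c x e₀ m s y :=
  ⟨h.zero, fun i hi => h.ends_eq i (hi.trans hm), fun i hi => h.mem i (hi.trans_le hm),
    fun i hi => h.missing i (hi.trans_le hm)⟩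

open Classical in
/-- Shifting colors along a fan: if the edge `e₀` cannot be added to a colored set, no color is
missing at both the center and an end of a fan that starts with `e₀`. -/
theorem IsFan.not_missing (he₀ : e₀ ∉ D)
    (hno : ¬ ∃ c : E → C, Proper ends (insert e₀ D) c) (n : ℕ) :
    ∀ (c : E → C), Proper ends D c → IsFan ends D c x e₀ n s y →
      ∀ a, Missing ends D c x a → ¬ Missing ends D c (y n) a := by
  -- The induction is strong because a repeated edge cuts the fan back to an arbitrary earlier
  -- point, and the coloring varies because the other case recolors an edge.
  induction n using Nat.strong_induction_on with
  | _ n ih =>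
  intro c hc hf a hx hy
  have hsn := hf.ends_eq n le_rfl
  have hat : ∀ e ∈ D, e ≠ s n → ∀ v, v ∈ ends e → v ∈ ends (s n) → c e ≠ a := by
    intro e he _ v hv hv'
    rw [hsn, Sym2.mem_iff] at hv'
    rcases hv' with rfl | rfl
    · exact hx e he hv
    · exact hy e he hv
  rcases n with _ | m
  · apply hno
    refine ⟨Function.update c e₀ a, ?_⟩
    rw [hf.zero] at hat
    intro e he e' he' hne v hv hv'
    rcases Finset.mem_insert.1 he with rfl | hD
    · have he'' : e' ∈ D := (Finset.mem_insert.1 he').resolve_left (Ne.symm hne)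
      rw [Function.update_self, Function.update_of_ne hne.symm]
      exact (hat e' he'' hne.symm v hv' hv).symm
    · have h1 : e ≠ e₀ := fun h => he₀ (h ▸ hD)
      rw [Function.update_of_ne h1]
      rcases Finset.mem_insert.1 he' with rfl | hD'
      · rw [Function.update_self]
        exact hat e hD hne v hv hv'
      · rw [Function.update_of_ne (fun h : e' = e₀ => he₀ (h ▸ hD'))]
        exact hc e hD e' hD' hne v hv hv'
  -- Fans may repeat edges. If the last edge occurs earlier, the shorter fan ending there has the
  -- same far end. Otherwise recoloring the last edge does not disturb the earlier part.
  by_cases hrep : ∃ i ≤ m, s i = s (m + 1)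
  · obtain ⟨i, hi, his⟩ := hrep
    have hyi : y i = y (m + 1) := by
      have := hf.ends_eq i (by omega)
      rw [his, hsn] at this
      exact (Sym2.congr_right.1 this).symm
    exact ih i (by omega) c hc (hf.mono (by omega)) a hx (hyi ▸ hy)
  push Not at hrep
  have hfD := hf.mem m (by omega)
  have hxf : x ∈ ends (s (m + 1)) := by rw [hsn]; simp
  have hcf := hx _ hfD hxf
  -- Once the last edge has color `a`, its old color is free at the center, and by the fan condition
  -- also at `y m`: the shorter fan is in the same situation.
  refine ih m (by omega) (Function.update c (s (m + 1)) a) ?_ ?_ (c (s (m + 1))) ?_ ?_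
  · intro e he e' he' hne v hv hv'
    by_cases h : e = s (m + 1)
    · subst h
      rw [Function.update_self, Function.update_of_ne hne.symm]
      exact (hat e' he' hne.symm v hv' hv).symm
    · rw [Function.update_of_ne h]
      by_cases h' : e' = s (m + 1)
      · subst h'
        rw [Function.update_self]
        exact hat e he hne v hv hv'
      · rw [Function.update_of_ne h']
        exact hc e he e' he' hne v hv hv'
  · refine ⟨hf.zero, fun i hi => hf.ends_eq i (by omega), fun i hi => hf.mem i (by omega), ?_⟩
    intro i hi e he hv
    rw [Function.update_of_ne (hrep (i + 1) (by omega))]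
    have h1 := hx _ (hf.mem i (by omega)) (by rw [hf.ends_eq (i + 1) (by omega)]; simp)
    by_cases h : e = s (m + 1)
    · subst h
      rw [Function.update_self]
      exact h1.symm
    · rw [Function.update_of_ne h]
      exact hf.missing i (by omega) e he hv
  · intro e he hv
    by_cases h : e = s (m + 1)
    · subst h
      rw [Function.update_self]
      exact hcf.symm
    · rw [Function.update_of_ne h]
      exact hc e he _ hfD h x hv hxf
  · intro e he hv
    by_cases h : e = s (m + 1)
    · subst h
      rw [Function.update_self]
      exact hcf.symm
    · rw [Function.update_of_ne h]
      exact hf.missing m (by omega) e he hv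

/-- Two vertices are adjacent if an edge of `D` of one of the colors `a` and `b` joins them. -/
def kempeGraph (ends : E → Sym2 X) (D : Finset E) (c : E → C) (a b : C) : SimpleGraph X where
  Adj v w := v ≠ w ∧ ∃ e ∈ D, ends e = s(v, w) ∧ (c e = a ∨ c e = b)
  symm := ⟨fun _ _ ⟨h, e, he, h1, h2⟩ => ⟨h.symm, e, he, h1.trans Sym2.eq_swap, h2⟩⟩
  loopless := ⟨fun _ h => h.1 rfl⟩

open Classical in
/-- The coloring in which the colors `a` and `b` are interchanged on the edges that meet `K`. -/
noncomputable def kempeSwap (ends : E → Sym2 X) (c : E → C) (a b : C) (K : Set X) (e : E) : C :=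
  if ∃ v ∈ K, v ∈ ends e then Equiv.swap a b (c e) else c e

section

variable {a b : C} {K : Set X}

open Classical in
theorem kempeSwap_of_mem {v : X} {e : E} (hv : v ∈ K) (hve : v ∈ ends e) :
    kempeSwap ends c a b K e = Equiv.swap a b (c e) :=
  if_pos ⟨v, hv, hve⟩

-- As `K` is closed under the Kempe graph, an edge leaving `K` has neither of the two colors, and
-- the interchange does nothing to it.
open Classical in
theorem kempeSwap_of_notMem
    (hK : ∀ v w, (kempeGraph ends D c a b).Adj v w → v ∈ K → w ∈ K) {v : X} {e : E} (he : e ∈ D)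
    (hv : v ∉ K) (hve : v ∈ ends e) : kempeSwap ends c a b K e = c e := by
  unfold kempeSwap
  split_ifs with h
  · obtain ⟨w, hw, hwe⟩ := h
    have hne : w ≠ v := fun h => hv (h ▸ hw)
    have hends : ends e = s(w, v) := (Sym2.mem_and_mem_iff hne).1 ⟨hwe, hve⟩
    by_cases hab : c e = a ∨ c e = b
    · exact absurd (hK w v ⟨hne, e, he, hends, hab⟩ hw) hv
    · push Not at hab
      exact Equiv.swap_apply_of_ne_of_ne hab.1 hab.2
  · rfl

open Classical in
theorem Proper.kempeSwap (hc : Proper ends D c)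
    (hK : ∀ v w, (kempeGraph ends D c a b).Adj v w → v ∈ K → w ∈ K) :
    Proper ends D (kempeSwap ends c a b K) := by
  intro e he e' he' hne v hv hv'
  by_cases h : v ∈ K
  · rw [kempeSwap_of_mem h hv, kempeSwap_of_mem h hv']
    exact fun h => hc e he e' he' hne v hv hv' ((Equiv.swap a b).injective h)
  · rw [kempeSwap_of_notMem hK he h hv, kempeSwap_of_notMem hK he' h hv']
    exact hc e he e' he' hne v hv hv'

open Classical in
theorem Missing.kempeSwap_of_mem {v : X} {d : C} (hv : v ∈ K)
    (h : Missing ends D c v (Equiv.swap a b d)) :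
    Missing ends D (kempeSwap ends c a b K) v d := by
  intro e he hve
  rw [EdgeColoring.kempeSwap_of_mem hv hve]
  intro h'
  refine h e he hve ?_
  rw [← h', Equiv.swap_apply_self]

theorem Missing.kempeSwap_of_notMem
    (hK : ∀ v w, (kempeGraph ends D c a b).Adj v w → v ∈ K → w ∈ K) {v : X} {d : C} (hv : v ∉ K)
    (h : Missing ends D c v d) : Missing ends D (EdgeColoring.kempeSwap ends c a b K) v d := by
  intro e he hve
  rw [EdgeColoring.kempeSwap_of_notMem hK he hv hve]
  exact h e he hve

end

open Classical in
/-- If the edge `e₀` cannot be added to a colored set, then each Kempe chain that starts at an end of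
a fan with a color missing there, and alternates with a color missing at the center, reaches the
center. -/
theorem IsFan.reachable (he₀ : e₀ ∉ D) (hno : ¬ ∃ c : E → C, Proper ends (insert e₀ D) c)
    (hc : Proper ends D c) {a b : C} (hx : Missing ends D c x b) (n : ℕ) :
    IsFan ends D c x e₀ n s y → Missing ends D c (y n) a →
      (kempeGraph ends D c a b).Reachable (y n) x := by
  induction n using Nat.strong_induction_on with
  | _ n ih =>
  intro hf hy
  -- Otherwise interchange the colors on the component of `y n`, which avoids the center. The fan
  -- survives, and `b` becomes missing at both its last end and the center, against
  -- `IsFan.not_missing`.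
  by_contra hr
  set K : Set X := {v | (kempeGraph ends D c a b).Reachable (y n) v} with hKdef
  have hK : ∀ v w, (kempeGraph ends D c a b).Adj v w → v ∈ K → w ∈ K :=
    fun _ _ h hv => SimpleGraph.Reachable.trans hv h.reachable
  have hxK : x ∉ K := hr
  have hyK : y n ∈ K := SimpleGraph.Reachable.refl _
  refine IsFan.not_missing (s := s) he₀ hno n (kempeSwap ends c a b K) (hc.kempeSwap hK) ?_ b
    (hx.kempeSwap_of_notMem hK hxK) (Missing.kempeSwap_of_mem hyK (by simpa using hy))
  refine ⟨hf.zero, hf.ends_eq, hf.mem, fun i hi => ?_⟩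
  have hxs : x ∈ ends (s (i + 1)) := by rw [hf.ends_eq (i + 1) (by omega)]; simp
  rw [kempeSwap_of_notMem hK (hf.mem i hi) hxK hxs]
  have hm := hf.missing i hi
  -- For `y i` in `K`, the fan condition could fail only if the next edge had color `a` or `b`.
  -- Color `b` is missing at the center; color `a` would be missing at `y i`, so by induction `y i`,
  -- and hence `y n`, would be connected to the center.
  by_cases hyi : y i ∈ K
  · apply Missing.kempeSwap_of_mem hyi
    have hb : c (s (i + 1)) ≠ b := hx _ (hf.mem i hi) hxs
    have ha : c (s (i + 1)) ≠ a := by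
      intro h
      rw [h] at hm
      exact hxK (SimpleGraph.Reachable.trans hyi (ih i hi (hf.mono hi.le) hm))
    rwa [Equiv.swap_apply_of_ne_of_ne ha hb]
  · exact hm.kempeSwap_of_notMem hK hyi


open Classical in
theorem card_le_card_missing [Finite E] [Fintype C] {k : ℕ} (v : X)
    (hk : {e | v ∈ ends e}.ncard + k ≤ Fintype.card C) : k ≤ (Finset.univ.filter fun a => Missing ends D c v a).card := by
  have h1 : (Finset.univ.filter fun a => ¬ Missing ends D c v a) ⊆
      {e | v ∈ ends e}.toFinite.toFinset.image c := by
    intro a ha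
    have ha' := (Finset.mem_filter.1 ha).2
    unfold Missing at ha'
    push Not at ha'
    obtain ⟨e, _, he, rfl⟩ := ha'
    exact Finset.mem_image_of_mem _ (by simpa using he)
  have h2 := (Finset.card_le_card h1).trans Finset.card_image_le
  rw [← Set.ncard_eq_toFinset_card] at h2
  have h3 := Finset.card_filter_add_card_filter_not (s := (Finset.univ : Finset C))
    (p := fun a => Missing ends D c v a)
  rw [Finset.card_univ] at h3
  omega

-- By properness, a neighbor is determined by the color of an edge leading to it. Hence the Kempe
-- graph has maximum degree at most 2, and vertices where one of two distinct colors is missing are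
-- ends of its components.
open Classical in
theorem degree_kempeGraph_le [Fintype X] (hc : Proper ends D c) (a b : C) (v : X) :
    (kempeGraph ends D c a b).degree v ≤
      (({a, b} : Finset C).filter fun d => ¬ Missing ends D c v d).card := by
  rcases isEmpty_or_nonempty E with hE | hE
  · rw [(SimpleGraph.degree_eq_zero _ _).2]
    · exact Nat.zero_le _
    · rintro w ⟨_, e, _⟩
      exact hE.elim e
  have hch : ∀ w : X, ∃ e, (kempeGraph ends D c a b).Adj v w →
      e ∈ D ∧ ends e = s(v, w) ∧ (c e = a ∨ c e = b) := by
    intro w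
    by_cases h : (kempeGraph ends D c a b).Adj v w
    · obtain ⟨_, e, he⟩ := h
      exact ⟨e, fun _ => he⟩
    · exact ⟨hE.some, fun h' => absurd h' h⟩
  choose g hg using hch
  rw [← SimpleGraph.card_neighborFinset_eq_degree]
  refine Finset.card_le_card_of_injOn (fun w => c (g w)) ?_ ?_
  · intro w hw
    obtain ⟨h1, h2, h3⟩ := hg w (by simpa using hw)
    simp only [Finset.coe_filter, Finset.mem_insert, Finset.mem_singleton, Set.mem_ofPred_eq]
    exact ⟨h3, fun h => h _ h1 (by rw [h2]; simp) rfl⟩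
  · intro w hw w' hw' heq
    obtain ⟨h1, h2, h3⟩ := hg w (by simpa using hw)
    obtain ⟨h1', h2', h3'⟩ := hg w' (by simpa using hw')
    have : g w = g w' := by
      by_contra hne
      exact hc _ h1 _ h1' hne v (by rw [h2]; simp) (by rw [h2']; simp) heq
    rw [this, h2'] at h2
    exact (Sym2.congr_right.1 h2).symm

open Classical in
/-- One more edge can be colored. -/
theorem exists_proper_insert [Finite E] [Fintype X] [Fintype C] (hloop : ∀ e, ¬ (ends e).IsDiag)
    {Δ μ : ℕ} (hΔ : ∀ v, {e | v ∈ ends e}.ncard ≤ Δ)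
    (hμ : ∀ e, {e' | ends e' = ends e}.ncard ≤ μ) (hC : Δ + μ ≤ Fintype.card C)
    (he₀ : e₀ ∉ D) (hc : Proper ends D c) : ∃ c : E → C, Proper ends (insert e₀ D) c := by
  have := Fintype.ofFinite E
  by_contra hno
  obtain ⟨x, y₀, hends₀⟩ : ∃ x y₀, ends e₀ = s(x, y₀) := by
    induction h : ends e₀ with | _ a b => exact ⟨a, b, rfl⟩
  have hmiss : ∀ v, μ ≤ (Finset.univ.filter fun a => Missing ends D c v a).card := fun v =>
    card_le_card_missing v (by have := hΔ v; omega)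
  have hμ0 : 0 < μ := by
    refine lt_of_lt_of_le ((Set.ncard_pos (Set.toFinite _)).2 ?_) (hμ e₀)
    exact ⟨e₀, rfl⟩
  -- One color missing at the center is fixed; all Kempe chains below alternate with it.
  obtain ⟨b, hb⟩ := Finset.card_pos.1 (hμ0.trans_le (hmiss x))
  replace hb : Missing ends D c x b := by simpa using hb
  -- the edges of fans, with their far ends
  let R : E → X → Prop := fun f z => ∃ n s y, IsFan ends D c x e₀ n s y ∧ s n = f ∧ y n = z
  have hRends : ∀ f z, R f z → ends f = s(x, z) := by
    rintro _ _ ⟨n, s, y, h, rfl, rfl⟩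
    exact h.ends_eq n le_rfl
  have hRmiss : ∀ f z, R f z → ∀ a, Missing ends D c z a → ¬ Missing ends D c x a := by
    rintro _ _ ⟨n, s, y, h, rfl, rfl⟩ a ha hx
    exact h.not_missing he₀ hno n c hc a hx ha
  have hRreach : ∀ f z, R f z → ∀ a, Missing ends D c z a →
      (kempeGraph ends D c a b).Reachable x z := by
    rintro _ _ ⟨n, s, y, h, rfl, rfl⟩ a ha
    exact (IsFan.reachable he₀ hno hc hb n h ha).symm
  have hRzero : R e₀ y₀ := by
    refine ⟨0, fun _ => e₀, fun _ => y₀, ⟨rfl, fun _ _ => hends₀, ?_, ?_⟩, rfl, rfl⟩ <;>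
    · intro i hi
      omega
  -- No freshness of the new edge has to be checked, because fans may repeat edges.
  have hRstep : ∀ f z, R f z → ∀ g ∈ D, x ∈ ends g → Missing ends D c z (c g) → ∃ w, R g w := by
    rintro _ _ ⟨n, s, y, h, rfl, rfl⟩ g hg hx hm
    obtain ⟨w, hw⟩ := Sym2.mem_iff_exists.1 hx
    refine ⟨w, n + 1, fun i => if i ≤ n then s i else g, fun i => if i ≤ n then y i else w,
      ⟨?_, ?_, ?_, ?_⟩, by simp, by simp⟩
    · simpa using h.zero
    · intro i hi
      split_ifs with hin
      · exact h.ends_eq i hin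
      · exact hw
    · intro i hi
      split_ifs with hin
      · exact h.mem i (by omega)
      · exact hg
    · intro i hi
      rw [if_pos (by omega : i ≤ n)]
      split_ifs with hin
      · exact h.missing i (by omega)
      · have : i = n := by omega
        subst this
        exact hm
  have hxz : ∀ f z, R f z → x ≠ z := by
    rintro f z h rfl
    exact hloop f (by rw [hRends _ _ h]; exact Sym2.mk_isDiag_iff.2 rfl)
  -- A color missing at two fan ends would put these and the center, three vertices of degree at
  -- most 1, into one component of a Kempe graph.
  have hdisj : ∀ f z, R f z → ∀ g w, R g w → z ≠ w → ∀ a, Missing ends D c z a →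
      ¬ Missing ends D c w a := by
    intro f z hf g w hg hzw a hz hw
    have hab : a ≠ b := by
      rintro rfl
      exact hRmiss f z hf a hz hb
    have hdeg := degree_kempeGraph_le hc a b
    have hcard : ({a, b} : Finset C).card = 2 := Finset.card_pair hab
    have hone : ∀ v d, d ∈ ({a, b} : Finset C) → Missing ends D c v d →
        (kempeGraph ends D c a b).degree v ≤ 1 := by
      intro v d hd hvd
      have : (({a, b} : Finset C).filter fun d => ¬ Missing ends D c v d).card <
          ({a, b} : Finset C).card :=
        Finset.card_lt_card (Finset.filter_ssubset.2 ⟨d, hd, not_not.2 hvd⟩)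
      have := hdeg v
      omega
    refine SimpleGraph.not_reachable_of_three_ends (kempeGraph ends D c a b) ?_ (hxz f z hf)
      (hxz g w hg) hzw (hone x b (by simp) hb) (hone z a (by simp) hz) (hone w a (by simp) hw)
      (hRreach f z hf a hz) (hRreach g w hg a hw)
    intro v
    exact (hdeg v).trans ((Finset.card_filter_le _ _).trans_eq hcard)
  -- Double counting. The fan edges number at most `μ` per far end. The far ends miss at least `μ`
  -- colors each, in disjoint sets, and every such color occurs at the center on an edge that
  -- prolongs a fan and differs from the uncolored `e₀`. So `|F| ≤ |Y| μ ≤ |F| - 1`.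
  set F : Finset E := Finset.univ.filter fun f => ∃ z, R f z with hF
  set Y : Finset X := Finset.univ.filter fun z => ∃ f, R f z with hY
  have hFcard : F.card ≤ Y.card * μ := by
    have hsub : F ⊆ Y.biUnion fun z => Finset.univ.filter fun e => ends e = s(x, z) := by
      intro f hf
      obtain ⟨z, hz⟩ := (Finset.mem_filter.1 hf).2
      exact Finset.mem_biUnion.2 ⟨z, by simpa [hY] using ⟨f, hz⟩, by simpa using hRends _ _ hz⟩
    refine (Finset.card_le_card hsub).trans (Finset.card_biUnion_le_card_mul _ _ _ ?_)
    intro z hz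
    obtain ⟨f, hf⟩ := (Finset.mem_filter.1 hz).2
    have := hμ f
    rw [hRends f z hf, Set.ncard_eq_toFinset_card'] at this
    convert this using 2
    ext
    simp
  have hMcard : Y.card * μ ≤
      (Y.biUnion fun z => Finset.univ.filter fun a => Missing ends D c z a).card := by
    rw [Finset.card_biUnion]
    · rw [← smul_eq_mul]
      exact Finset.card_nsmul_le_sum _ _ _ fun z _ => hmiss z
    · intro z hz w hw hzw
      obtain ⟨f, hf⟩ := (Finset.mem_filter.1 hz).2
      obtain ⟨g, hg⟩ := (Finset.mem_filter.1 hw).2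
      refine Finset.disjoint_left.2 ?_
      intro a ha ha'
      exact hdisj f z hf g w hg hzw a (by simpa using ha) (by simpa using ha')
  have hle : (Y.biUnion fun z => Finset.univ.filter fun a => Missing ends D c z a).card ≤
      (F.erase e₀).card := by
    have hsub : (Y.biUnion fun z => Finset.univ.filter fun a => Missing ends D c z a) ⊆
        (F.erase e₀).image c := by
      intro a ha
      obtain ⟨z, hz, ha⟩ := Finset.mem_biUnion.1 ha
      obtain ⟨f, hf⟩ := (Finset.mem_filter.1 hz).2
      replace ha : Missing ends D c z a := by simpa using ha
      have := hRmiss f z hf a ha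
      unfold Missing at this
      push Not at this
      obtain ⟨g, hg, hxg, rfl⟩ := this
      refine Finset.mem_image_of_mem _ (Finset.mem_erase.2 ⟨fun h => he₀ (h ▸ hg), ?_⟩)
      simpa [hF] using hRstep f z hf g hg hxg ha
    exact (Finset.card_le_card hsub).trans Finset.card_image_le
  have hmem : e₀ ∈ F := by simpa [hF] using ⟨y₀, hRzero⟩
  have := Finset.card_erase_lt_of_mem hmem
  omega

/-- **Vizing's theorem** for multigraphs: if every vertex has degree at most `Δ`, and every edge at
most `μ` parallels (itself included), then the edges can be colored with `Δ + μ` colors. -/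
theorem exists_coloring [Finite E] [Finite X] (hloop : ∀ e, ¬ (ends e).IsDiag)
    {Δ μ : ℕ} (hΔ : ∀ v, {e | v ∈ ends e}.ncard ≤ Δ)
    (hμ : ∀ e, {e' | ends e' = ends e}.ncard ≤ μ) :
    ∃ c : E → Fin (Δ + μ), ∀ e e', e ≠ e' → ∀ v, v ∈ ends e → v ∈ ends e' → c e ≠ c e' := by
  classical
  have := Fintype.ofFinite E
  have := Fintype.ofFinite X
  have key : ∀ D : Finset E, ∃ c : E → Fin (Δ + μ), Proper ends D c := by
    intro D
    induction D using Finset.induction_on with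
    | empty =>
      -- Without edges the palette may be empty; an edge forces `μ > 0`, which makes a default color
      -- available.
      rcases isEmpty_or_nonempty E with h | ⟨⟨e⟩⟩
      · exact ⟨fun e => h.elim e, by simp [Proper]⟩
      · have hμ0 : 0 < μ := by
          refine lt_of_lt_of_le ((Set.ncard_pos (Set.toFinite _)).2 ?_) (hμ e)
          exact ⟨e, rfl⟩
        exact ⟨fun _ => ⟨0, by omega⟩, by simp [Proper]⟩
    | insert e₀ D he₀ ih =>
      obtain ⟨c, hc⟩ := ih
      exact exists_proper_insert hloop hΔ hμ (by simp) he₀ hc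
  obtain ⟨c, hc⟩ := key Finset.univ
  exact ⟨c, fun e e' => hc e (Finset.mem_univ _) e' (Finset.mem_univ _)⟩

end EdgeColoring

/-! ### Cuts and facial walks modulo 2 -/

theorem Equiv.Perm.SameCycle.apply_eq_of_invariant {α β : Type*} {p : Equiv.Perm α} {φ : α → β}
    (hφ : ∀ a, φ (p a) = φ a) {a b : α} (h : p.SameCycle a b) : φ a = φ b := by
  obtain ⟨n, rfl⟩ := h
  induction n generalizing a with
  | zero => rfl
  | succ n ih => rw [zpow_add_one, Equiv.Perm.mul_apply, ← ih, hφ]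
  | pred n ih =>
    rw [zpow_sub_one, Equiv.Perm.mul_apply, ← ih, ← hφ (p⁻¹ a)]
    exact (congrArg φ (p.apply_symm_apply a)).symm

namespace PlaneGraph

variable {V : Type u} (G : PlaneGraph V)

theorem faceOf_facePerm (d : G.graph.Dart) : G.faceOf (G.facePerm d) = G.faceOf d :=
  Quotient.sound ((Equiv.Perm.SameCycle.refl _ _).apply_left)

theorem facePerm_fst (d : G.graph.Dart) : (G.facePerm d).fst = d.snd :=
  G.rot_fst d.symm

instance [Finite V] : Finite G.graph.Dart :=
  Finite.of_injective _ SimpleGraph.Dart.toProd_injective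

instance [Finite V] : Finite G.Face :=
  inferInstanceAs (Finite (Quotient _))

theorem eq_of_forall_dart_eq {α : Type*} {x : V → α} (hx : ∀ d : G.graph.Dart, x d.fst = x d.snd)
    (v w : V) : x v = x w := by
  obtain ⟨p⟩ := G.connected.preconnected v w
  induction p with
  | nil => rfl
  | cons h p ih => exact (hx ⟨(_, _), h⟩).trans ih

/-- The dual graph is connected. -/
theorem face_eq_of_forall_dart_eq {α : Type*} {s : G.Face → α}
    (hs : ∀ d, s (G.faceOf d) = s (G.faceOf d.symm)) (f g : G.Face) : s f = s g := by
  -- The dart `rot d` is the facial successor of `d.symm`, so turning around a vertex crosses one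
  -- edge at a time.
  have hrot : ∀ d, s (G.faceOf (G.rot d)) = s (G.faceOf d) := by
    intro d
    rw [hs d, ← G.faceOf_facePerm d.symm]
    simp [facePerm]
  have hvertex : ∀ d e : G.graph.Dart, d.fst = e.fst → s (G.faceOf d) = s (G.faceOf e) := by
    intro d e h
    exact (G.rot_cyclic d e h).apply_eq_of_invariant (φ := fun d => s (G.faceOf d)) hrot
  have key : ∀ v w, G.graph.Walk v w → ∀ d e : G.graph.Dart, d.fst = v → e.fst = w →
      s (G.faceOf d) = s (G.faceOf e) := by
    intro v w p
    induction p with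
    | nil => intro d e hd he; exact hvertex d e (hd.trans he.symm)
    | @cons a b c h p ih =>
      intro d e hd he
      rw [hvertex d ⟨(a, b), h⟩ hd, hs]
      exact ih _ _ rfl he
  obtain ⟨d, rfl⟩ : ∃ d, G.faceOf d = f := Quotient.exists_rep f
  obtain ⟨e, rfl⟩ : ∃ e, G.faceOf e = g := Quotient.exists_rep g
  obtain ⟨p⟩ := G.connected.preconnected d.fst e.fst
  exact key _ _ p d e rfl rfl

section

open Classical in
theorem sum_dart_eq_sum_edge [Fintype G.graph.Dart] [Fintype G.graph.edgeSet] {M : Type*}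
    [AddCommMonoid M] {r : G.graph.edgeSet → G.graph.Dart} (hr : ∀ e, (r e).edge = e)
    (g : G.graph.Dart → M) : ∑ d, g d = ∑ e, (g (r e) + g (r e).symm) := by
  rw [← Finset.sum_fiberwise (s := Finset.univ)
    (g := fun d : G.graph.Dart => (⟨d.edge, d.edge_mem⟩ : G.graph.edgeSet))]
  refine Finset.sum_congr rfl fun e _ => ?_
  have : (Finset.univ.filter fun d : G.graph.Dart =>
      (⟨d.edge, d.edge_mem⟩ : G.graph.edgeSet) = e) = {r e, (r e).symm} := by
    ext d
    simp [Subtype.ext_iff, ← hr e, SimpleGraph.dart_edge_eq_iff]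
  rw [this, Finset.sum_pair (r e).symm_ne.symm]

open Classical in
/-- A set of edges (given by its characteristic function modulo 2) that every facial walk
traverses an even number of times is a cut: this is exactness of the cellular cochain complex of the
sphere in the middle. -/
theorem exists_cut_of_sum_face_eq_zero [Finite V] [Fintype G.graph.Dart] [Nonempty G.graph.Dart]
    (y : Sym2 V → ZMod 2) (hy : ∀ f, ∑ d, (if G.faceOf d = f then y d.edge else 0) = 0) :
    ∃ x : V → ZMod 2, ∀ d : G.graph.Dart, x d.fst + x d.snd = y d.edge := by
  have := Fintype.ofFinite V
  have := Fintype.ofFinite G.Face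
  have := Fintype.ofFinite G.graph.edgeSet
  have hr : ∀ e : G.graph.edgeSet, ∃ d : G.graph.Dart, d.edge = e := by
    rintro ⟨e, he⟩
    induction e with | _ a b => exact ⟨⟨(a, b), he⟩, rfl⟩
  choose r hr using hr
  -- The matrix `A` is the coboundary from vertices to edges, and the transpose of `B` the one from
  -- edges to faces. Exactness in the middle follows from one inclusion and equality of dimensions.
  let A : Matrix G.graph.edgeSet V (ZMod 2) :=
    Matrix.of fun e v => (if (r e).fst = v then 1 else 0) + if (r e).snd = v then 1 else 0
  -- An edge with the same face on both sides is traversed twice by it and gets the entry `1 + 1 =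
  -- 0`.
  let B : Matrix G.graph.edgeSet G.Face (ZMod 2) := Matrix.of fun e f =>
    (if G.faceOf (r e) = f then 1 else 0) + if G.faceOf (r e).symm = f then 1 else 0
  have hA : ∀ x e, (A.mulVec x) e = x (r e).fst + x (r e).snd := by
    intro x e
    simp [A, Matrix.mulVec, dotProduct, add_mul, Finset.sum_add_distrib]
  have hB : ∀ s e, (B.mulVec s) e = s (G.faceOf (r e)) + s (G.faceOf (r e).symm) := by
    intro x e
    simp [B, Matrix.mulVec, dotProduct, add_mul, Finset.sum_add_distrib]
  have hBT : ∀ (z : Sym2 V → ZMod 2) f, (B.transpose.mulVec fun e => z e) f =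
      ∑ d, (if G.faceOf d = f then z d.edge else 0) := by
    intro z f
    rw [G.sum_dart_eq_sum_edge hr]
    refine Finset.sum_congr rfl fun e _ => ?_
    simp [B, add_mul, hr]
  have hchar : ∀ a b : ZMod 2, a + b = 0 ↔ a = b := by decide
  have hall : ∀ (x : V → ZMod 2) (z : Sym2 V → ZMod 2),
      (∀ e, x (r e).fst + x (r e).snd = z e) → ∀ d : G.graph.Dart,
        x d.fst + x d.snd = z d.edge := by
    intro x z h d
    have := h ⟨d.edge, d.edge_mem⟩
    rcases (SimpleGraph.dart_edge_eq_iff _ _).1 (hr ⟨d.edge, d.edge_mem⟩) with h' | h'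
    · rwa [h'] at this
    · rw [h'] at this
      rw [add_comm]
      exact this
  have hkerA : Module.finrank (ZMod 2) (LinearMap.ker A.mulVecLin) = 1 := by
    have : LinearMap.ker A.mulVecLin = Submodule.span (ZMod 2) {fun _ => 1} := by
      ext x
      rw [LinearMap.mem_ker, Matrix.mulVecLin_apply, Submodule.mem_span_singleton]
      constructor
      · intro h
        have hc := G.eq_of_forall_dart_eq (x := x) fun d => (hchar _ _).1
          (hall x (fun _ => 0) (fun e => by rw [← hA, h]; rfl) d)
        obtain ⟨d⟩ := ‹Nonempty G.graph.Dart›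
        refine ⟨x d.fst, funext fun v => ?_⟩
        simpa using hc d.fst v
      · rintro ⟨a, rfl⟩
        ext e
        rw [hA]
        exact (hchar _ _).2 rfl
    rw [this, finrank_span_singleton]
    intro h
    obtain ⟨d⟩ := ‹Nonempty G.graph.Dart›
    exact one_ne_zero (congrFun h d.fst)
  have hkerB : Module.finrank (ZMod 2) (LinearMap.ker B.mulVecLin) = 1 := by
    have : LinearMap.ker B.mulVecLin = Submodule.span (ZMod 2) {fun _ => 1} := by
      ext s
      rw [LinearMap.mem_ker, Matrix.mulVecLin_apply, Submodule.mem_span_singleton]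
      constructor
      · intro h
        have hc := G.face_eq_of_forall_dart_eq (s := s) fun d => by
          have hd := (hchar _ _).1 ((hB s ⟨d.edge, d.edge_mem⟩).symm.trans (congrFun h _))
          rcases (SimpleGraph.dart_edge_eq_iff _ _).1 (hr ⟨d.edge, d.edge_mem⟩) with h' | h'
          · rwa [h'] at hd
          · rw [h', SimpleGraph.Dart.symm_symm] at hd
            exact hd.symm
        obtain ⟨d⟩ := ‹Nonempty G.graph.Dart›
        refine ⟨s (G.faceOf d), funext fun v => ?_⟩
        simpa using hc (G.faceOf d) v
      · rintro ⟨a, rfl⟩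
        ext e
        rw [hB]
        exact (hchar _ _).2 rfl
    rw [this, finrank_span_singleton]
    intro h
    obtain ⟨d⟩ := ‹Nonempty G.graph.Dart›
    exact one_ne_zero (congrFun h (G.faceOf d))
  have hle : LinearMap.range A.mulVecLin ≤ LinearMap.ker B.transpose.mulVecLin := by
    rintro _ ⟨x, rfl⟩
    rw [LinearMap.mem_ker, Matrix.mulVecLin_apply, Matrix.mulVecLin_apply]
    let z : Sym2 V → ZMod 2 := Sym2.lift ⟨fun a b => x a + x b, fun a b => add_comm _ _⟩
    have hz : A.mulVec x = fun e : G.graph.edgeSet => z e := by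
      ext e
      rw [hA, ← hr e]
      rfl
    rw [hz]
    ext f
    rw [hBT]
    -- The second end of a dart is the first end of its facial successor, so along a facial walk
    -- each occurrence of a vertex is counted twice.
    have h1 : ∀ d : G.graph.Dart, (if G.faceOf d = f then z d.edge else 0) =
        (if G.faceOf d = f then x d.fst else 0) +
          (if G.faceOf (G.facePerm d) = f then x (G.facePerm d).fst else 0) := by
      intro d
      rw [G.faceOf_facePerm, G.facePerm_fst]
      split_ifs
      · rfl
      · rfl
    simp only [h1, Finset.sum_add_distrib]
    rw [Equiv.sum_comp G.facePerm fun d => if G.faceOf d = f then x d.fst else 0]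
    exact (hchar _ _).2 rfl
  -- Since both kernels are the constants, the dimensions are `|V| - 1` and `|E| - (|F| - 1)`, which
  -- agree by Euler's formula.
  have hfin : Module.finrank (ZMod 2) (LinearMap.range A.mulVecLin) =
      Module.finrank (ZMod 2) (LinearMap.ker B.transpose.mulVecLin) := by
    have e1 := LinearMap.finrank_range_add_finrank_ker A.mulVecLin
    have e2 := LinearMap.finrank_range_add_finrank_ker B.mulVecLin
    have e3 := LinearMap.finrank_range_add_finrank_ker B.transpose.mulVecLin
    have e4 : Module.finrank (ZMod 2) (LinearMap.range B.transpose.mulVecLin) =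
      Module.finrank (ZMod 2) (LinearMap.range B.mulVecLin) := B.rank_transpose
    rw [Module.finrank_fintype_fun_eq_card, ← Nat.card_eq_fintype_card] at e1 e2 e3
    have e5 : (Nat.card V : ℤ) - Nat.card G.graph.edgeSet + Nat.card G.Face = 2 := G.euler
    omega
  have heq := Submodule.eq_of_le_of_finrank_eq hle hfin
  have hmem : (fun e : G.graph.edgeSet => y e) ∈ LinearMap.ker B.transpose.mulVecLin := by
    rw [LinearMap.mem_ker, Matrix.mulVecLin_apply]
    ext f
    rw [hBT]
    exact hy f
  rw [← heq] at hmem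
  obtain ⟨x, hx⟩ := hmem
  refine ⟨x, hall x y fun e => ?_⟩
  rw [← hA]
  exact congrFun hx e

-- Only the two darts of the edge contribute, one for each side. This verifies the parity condition
-- for sets of one or two edges.
open Classical in
theorem sum_face_single [Fintype G.graph.Dart] (d : G.graph.Dart) (f : G.Face) :
    ∑ d' : G.graph.Dart, (if G.faceOf d' = f then (if d'.edge = d.edge then (1 : ZMod 2) else 0)
      else 0) = (if G.faceOf d = f then 1 else 0) + if G.faceOf d.symm = f then 1 else 0 := by
  have h : ∀ d' : G.graph.Dart, (if G.faceOf d' = f then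
      (if d'.edge = d.edge then (1 : ZMod 2) else 0) else 0) =
      (if d' = d then (if G.faceOf d = f then 1 else 0) else 0) +
        if d' = d.symm then (if G.faceOf d.symm = f then 1 else 0) else 0 := by
    intro d'
    by_cases h1 : d' = d
    · subst h1
      simp [d'.symm_ne.symm]
    · by_cases h2 : d' = d.symm
      · subst h2
        simp [d.symm_ne]
      · have : d'.edge ≠ d.edge := by
          rw [Ne, SimpleGraph.dart_edge_eq_iff]
          simp [h1, h2]
        simp [h1, h2, this]
  simp only [h, Finset.sum_add_distrib, Finset.sum_ite_eq', Finset.mem_univ, if_true]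

end

/-! ### The dual of a 3-connected plane graph is simple -/

variable {G}

/-- In a 3-connected graph no two edges form a cut. -/
theorem IsThreeConnected.not_cut [Finite V] (h3 : G.IsThreeConnected) {A : Set V} {a₁ b₁ a₂ b₂ : V}
    (ha₁ : a₁ ∈ A) (hb₁ : b₁ ∉ A) (ha₂ : a₂ ∈ A) (hb₂ : b₂ ∉ A)
    (hcut : ∀ v w, G.graph.Adj v w → v ∈ A → w ∉ A → (v = a₁ ∧ w = b₁) ∨ (v = a₂ ∧ w = b₂)) :
    False := by
  classical
  -- Deleting one end of each of the two edges destroys every crossing, so it must not leave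
  -- vertices on both sides.
  have key : ∀ p q, (p = a₁ ∨ p = b₁) → (q = a₂ ∨ q = b₂) → ∀ u v, u ∈ A → v ∉ A → u ≠ p → u ≠ q →
      v ≠ p → v ≠ q → False := by
    intro p q hp hq u v hu hv hup huq hvp hvq
    have hS : ({p, q} : Set V).ncard < 3 := by
      have := Set.ncard_insert_le p {q}
      rw [Set.ncard_singleton] at this
      omega
    obtain ⟨W⟩ := (h3.2 {p, q} hS).preconnected ⟨u, by simp [hup, huq]⟩ ⟨v, by simp [hvp, hvq]⟩
    have : ∀ (x y : ({p, q}ᶜ : Set V)), (G.graph.induce {p, q}ᶜ).Walk x y → x.1 ∈ A →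
        y.1 ∈ A := by
      intro x y P
      induction P with
      | nil => exact id
      | @cons a b c h P ih =>
        intro ha
        apply ih
        by_contra hb
        have h1 := a.2
        have h2 := b.2
        simp only [Set.mem_compl_iff, Set.mem_insert_iff, Set.mem_singleton_iff] at h1 h2
        have := hcut a b h ha hb
        grind
    exact hv (this _ _ W hu)
  by_cases hA : ∃ u ∈ A, u ≠ a₁ ∧ u ≠ a₂
  · obtain ⟨u, hu, h1, h2⟩ := hA
    exact key a₁ a₂ (Or.inl rfl) (Or.inl rfl) u b₁ hu hb₁ h1 h2
      (fun h => hb₁ (h ▸ ha₁)) (fun h => hb₁ (h ▸ ha₂))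
  by_cases hB : ∃ v, v ∉ A ∧ v ≠ b₁ ∧ v ≠ b₂
  · obtain ⟨v, hv, h1, h2⟩ := hB
    exact key b₁ b₂ (Or.inr rfl) (Or.inr rfl) a₁ v ha₁ hv
      (fun h => hb₁ (h ▸ ha₁)) (fun h => hb₂ (h ▸ ha₁)) h1 h2
  push Not at hA hB
  have huniv : (Set.univ : Set V) ⊆ ({a₁, a₂, b₁, b₂} : Finset V) := by
    intro v _
    by_cases hv : v ∈ A
    · have := hA v hv
      simp
      tauto
    · have := hB v hv
      simp
      tauto
  have hcard := Set.ncard_le_ncard huniv (Set.toFinite _)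
  rw [Set.ncard_univ, Set.ncard_coe_finset] at hcard
  have h4 := h3.1
  -- Only the four ends remain as vertices, and there are at least four vertices, so the ends are
  -- distinct. Deleting one end of each edge on opposite sides then separates the other two.
  have hne : a₂ ≠ a₁ ∧ b₁ ≠ b₂ := by
    constructor
    · rintro rfl
      have : ({a₂, a₂, b₁, b₂} : Finset V) = {a₂, b₁, b₂} := by simp
      rw [this] at hcard
      have := Finset.card_le_three (a := a₂) (b := b₁) (c := b₂)
      omega
    · rintro rfl
      have : ({a₁, a₂, b₁, b₁} : Finset V) = {a₁, a₂, b₁} := by simp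
      rw [this] at hcard
      have := Finset.card_le_three (a := a₁) (b := a₂) (c := b₁)
      omega
  exact key a₁ b₂ (Or.inl rfl) (Or.inr rfl) a₂ b₁ ha₂ hb₁ hne.1 (fun h => hb₂ (h ▸ ha₂))
    (fun h => hb₁ (h ▸ ha₁)) hne.2

/-- The form in which cuts come from `exists_cut_of_sum_face_eq_zero`. The darts may coincide, which
covers bridges. -/
theorem IsThreeConnected.not_cut_dart [Finite V] (h3 : G.IsThreeConnected) {x : V → ZMod 2}
    (d e : G.graph.Dart) (hd : x d.fst ≠ x d.snd) (he : x e.fst ≠ x e.snd)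
    (hcut : ∀ d' : G.graph.Dart, x d'.fst ≠ x d'.snd → d'.edge = d.edge ∨ d'.edge = e.edge) :
    False := by
  have h01 : ∀ a b : ZMod 2, a ≠ b → (a = 0 ∧ b ≠ 0) ∨ (b = 0 ∧ a ≠ 0) := by decide
  obtain ⟨d', hd', h1, h2⟩ : ∃ d' : G.graph.Dart, d'.edge = d.edge ∧ x d'.fst = 0 ∧ x d'.snd ≠ 0 := by
    rcases h01 _ _ hd with h | h
    · exact ⟨d, rfl, h⟩
    · exact ⟨d.symm, d.edge_symm, h⟩
  obtain ⟨e', he', h3', h4⟩ : ∃ e' : G.graph.Dart, e'.edge = e.edge ∧ x e'.fst = 0 ∧ x e'.snd ≠ 0 := by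
    rcases h01 _ _ he with h | h
    · exact ⟨e, rfl, h⟩
    · exact ⟨e.symm, e.edge_symm, h⟩
  refine h3.not_cut (A := {v | x v = 0}) h1 h2 h3' h4 ?_
  intro v w hvw (hv : x v = 0) (hw : ¬ x w = 0)
  have := hcut ⟨(v, w), hvw⟩ (fun h => hw (h.symm.trans hv))
  rw [← hd', ← he'] at this
  have hsym : ∀ k : G.graph.Dart, x k.fst = 0 → x k.snd ≠ 0 →
      (⟨(v, w), hvw⟩ : G.graph.Dart).edge = k.edge → v = k.fst ∧ w = k.snd := by
    intro k hk1 hk2 h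
    rcases SimpleGraph.dart_edge_eq_iff _ _ |>.1 h with h | h
    · rw [← h]; exact ⟨rfl, rfl⟩
    · have : w = k.fst := congrArg (fun d : G.graph.Dart => d.snd) h
      exact absurd hk1 (this ▸ hw)
  exact this.imp (hsym d' h1 h2) (hsym e' h3' h4)

/-- The dual of a 3-connected plane graph has no loops. -/
theorem IsThreeConnected.faceOf_ne_faceOf_symm [Finite V] (h3 : G.IsThreeConnected)
    (d : G.graph.Dart) : G.faceOf d ≠ G.faceOf d.symm := by
  classical
  intro h
  have := Fintype.ofFinite G.graph.Dart
  have : Nonempty G.graph.Dart := ⟨d⟩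
  have hchar : ∀ a : ZMod 2, a + a = 0 := by decide
  have hne : ∀ a b : ZMod 2, a ≠ b ↔ a + b = 1 := by decide
  -- With one face on both sides, the single edge is met evenly by every face, so it would be a
  -- bridge.
  obtain ⟨x, hx⟩ := G.exists_cut_of_sum_face_eq_zero (fun e => if e = d.edge then 1 else 0)
    fun f => by rw [G.sum_face_single, ← h, hchar]
  refine h3.not_cut_dart (x := x) d d ?_ ?_ fun d' hd' => ?_
  · rw [hne, hx, if_pos rfl]
  · rw [hne, hx, if_pos rfl]
  · rw [hne, hx] at hd'
    by_contra hcon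
    rw [if_neg (by tauto)] at hd'
    exact zero_ne_one hd'

/-- The dual of a 3-connected plane graph has no multiple edges. -/
theorem IsThreeConnected.edge_eq_of_faces_eq [Finite V] (h3 : G.IsThreeConnected)
    (d e : G.graph.Dart)
    (h : s(G.faceOf d, G.faceOf d.symm) = s(G.faceOf e, G.faceOf e.symm)) :
    d.edge = e.edge := by
  classical
  by_contra hde
  have := Fintype.ofFinite G.graph.Dart
  have : Nonempty G.graph.Dart := ⟨d⟩
  have hchar : ∀ a : ZMod 2, a + a = 0 := by decide
  have hne : ∀ a b : ZMod 2, a ≠ b ↔ a + b = 1 := by decide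
  -- Each face meets the pair of edges evenly, because they have the same two sides; the pair would
  -- be a cut.
  obtain ⟨x, hx⟩ := G.exists_cut_of_sum_face_eq_zero
    (fun k => (if k = d.edge then 1 else 0) + if k = e.edge then 1 else 0) fun f => by
      have hsplit : ∀ (p : Prop) [Decidable p] (a b : ZMod 2), (if p then a + b else 0) =
          (if p then a else 0) + if p then b else 0 := by
        intro p _ a b
        split_ifs <;> simp
      simp only [hsplit, Finset.sum_add_distrib]
      rw [G.sum_face_single, G.sum_face_single]
      rcases Sym2.eq_iff.1 h with ⟨h1, h2⟩ | ⟨h1, h2⟩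
      · rw [h1, h2, hchar]
      · rw [h1, h2, add_comm (ite _ _ _), hchar]
  refine h3.not_cut_dart (x := x) d e ?_ ?_ fun d' hd' => ?_
  · rw [hne, hx, if_pos rfl, if_neg hde, add_zero]
  · rw [hne, hx, if_pos rfl, if_neg (Ne.symm hde), zero_add]
  · rw [hne, hx] at hd'
    by_contra hcon
    push Not at hcon
    rw [if_neg hcon.1, if_neg hcon.2, add_zero] at hd'
    exact zero_ne_one hd'

end PlaneGraph

/-! ### Faces and new vertices of a subdivision, and the upper bound -/

namespace PlaneGraph

variable {V : Type u} {G : PlaneGraph V}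

theorem apply_eq_of_faceOf_eq {α : Type*} {φ : G.graph.Dart → α} (hφ : ∀ d, φ (G.facePerm d) = φ d)
    {d e : G.graph.Dart} (h : G.faceOf d = G.faceOf e) : φ d = φ e :=
  Equiv.Perm.SameCycle.apply_eq_of_invariant hφ (Quotient.exact h)

theorem exists_isCyclicColoring [Finite V] (G : PlaneGraph V) :
    ∃ c : V → Fin G.cyclicChromaticNumber, G.IsCyclicColoring c := by
  have hne : {k : ℕ | ∃ c : V → Fin k, G.IsCyclicColoring c}.Nonempty :=
    ⟨Nat.card V, Finite.equivFin V, fun _ _ _ _ _ h => (Finite.equivFin V).injective.ne h⟩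
  exact Nat.sInf_mem hne

theorem cyclicChromaticNumber_le {C : Type*} [Finite C] {c : V → C} (hc : G.IsCyclicColoring c) :
    G.cyclicChromaticNumber ≤ Nat.card C :=
  Nat.sInf_le ⟨fun v => Finite.equivFin C (c v),
    fun f x y hx hy hxy h => hc f x y hx hy hxy ((Finite.equivFin C).injective h)⟩

/-- Strict, because `longestTwoPath` counts vertices and `length` counts edges. Finiteness bounds
the set whose supremum is taken. -/
theorem length_lt_longestTwoPath [Finite V] {x y : V} {p : G.graph.Walk x y} (hp : p.IsPath)
    (h : ∀ w ∈ p.support, (G.graph.neighborSet w).ncard = 2) :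
    p.length < G.longestTwoPath := by
  have := Fintype.ofFinite V
  rw [← Nat.succ_le_iff]
  refine le_csSup ⟨Fintype.card V, ?_⟩ ⟨x, y, p, hp, h, SimpleGraph.Walk.length_support p⟩
  rintro _ ⟨x, y, p, hp, -, rfl⟩
  rw [SimpleGraph.Walk.length_support]
  exact hp.length_lt

end PlaneGraph

namespace PlaneSubdivision

variable {V : Type u} {W : Type v} {R : PlaneGraph V} {G : PlaneGraph W}
  (S : PlaneSubdivision R G) (d : R.graph.Dart)

theorem darts_getElem {i : ℕ} (hi : i < (S.path d).darts.length) :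
    ((S.path d).darts[i]).fst = (S.path d).getVert i ∧
      ((S.path d).darts[i]).snd = (S.path d).getVert (i + 1) := by
  simp [SimpleGraph.Walk.darts_getElem_eq_getVert]

theorem mem_support_symm {w : W} : w ∈ (S.path d.symm).support ↔ w ∈ (S.path d).support := by
  have h : (S.path d.symm).support = (S.path d).reverse.support :=
    congrArg (fun p => SimpleGraph.Walk.support p) (S.path_symm d)
  rw [h, SimpleGraph.Walk.support_reverse, List.mem_reverse]

variable {d} in
theorem getVert_inj {i j : ℕ} (hi : i ≤ (S.path d).length) (hj : j ≤ (S.path d).length)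
    (h : (S.path d).getVert i = (S.path d).getVert j) : i = j :=
  (S.path_isPath d).getVert_injOn hi hj h

theorem getVert_mem_range {i : ℕ} (hi : i ≤ (S.path d).length)
    (h : (S.path d).getVert i ∈ Set.range S.branch) : i = 0 ∨ i = (S.path d).length := by
  obtain ⟨x, hx⟩ := h
  rcases S.branch_mem_path d x (hx ▸ SimpleGraph.Walk.getVert_mem_support _ _) with rfl | rfl
  · exact Or.inl (S.getVert_inj hi (by omega) (by rw [← hx]; simp))
  · exact Or.inr (S.getVert_inj hi le_rfl (by rw [← hx]; simp))

theorem length_path_pos : 0 < (S.path d).length :=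
  SimpleGraph.Walk.not_nil_iff_lt_length.1 (S.not_nil d)

/-- The paths through an inner vertex replace the same edge. -/
theorem eq_or_eq_symm {d e : R.graph.Dart} {w : W} (hw : w ∉ Set.range S.branch)
    (hd : w ∈ (S.path d).support) (he : w ∈ (S.path e).support) : e = d ∨ e = d.symm := by
  rw [← SimpleGraph.dart_edge_eq_iff]
  by_contra h
  exact hw (S.path_disjoint e d w he hd h)

/-- The darts that leave an inner vertex of a path are the two darts on the path. -/
theorem eq_of_fst_eq_getVert {i : ℕ} (hi : i + 1 < (S.path d).darts.length) {k : G.graph.Dart}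
    (hk : k.fst = (S.path d).getVert (i + 1)) :
    k = ((S.path d).darts[i]).symm ∨ k = (S.path d).darts[i + 1] := by
  have hl : (S.path d).darts.length = (S.path d).length := SimpleGraph.Walk.length_darts _
  have hnb : (S.path d).getVert (i + 1) ∉ Set.range S.branch := by
    intro h
    have := S.getVert_mem_range d (by omega) h
    omega
  obtain ⟨e, he⟩ := S.exists_path k
  have hke := SimpleGraph.Walk.dart_fst_mem_support_of_mem_darts _ he
  rw [hk] at hke
  rcases S.eq_or_eq_symm hnb (SimpleGraph.Walk.getVert_mem_support _ _) hke with rfl | rfl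
  · right
    obtain ⟨j, hj, rfl⟩ := List.getElem_of_mem he
    rw [(S.darts_getElem e hj).1] at hk
    obtain rfl := S.getVert_inj (by omega) (by omega) hk
    rfl
  · left
    rw [S.mem_path_symm] at he
    obtain ⟨j, hj, hjk⟩ := List.getElem_of_mem he
    have h1 : k.symm.snd = (S.path d).getVert (j + 1) := by rw [← hjk, (S.darts_getElem d hj).2]
    have h2 := S.getVert_inj (by omega) (by omega) (hk.symm.trans h1)
    obtain rfl : i = j := by omega
    rw [hjk, SimpleGraph.Dart.symm_symm]

/-- The rotation at an inner vertex is transitive on the darts leaving it, the two on the path. If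
it fixed the one pointing back, the next dart of the path would have to coincide with that one. -/
theorem facePerm_getElem {i : ℕ} (hi : i + 1 < (S.path d).darts.length) :
    G.facePerm (S.path d).darts[i] = (S.path d).darts[i + 1] := by
  have h1 := (S.darts_getElem d (by omega : i < _)).2
  have h2 : G.facePerm (S.path d).darts[i] = G.rot ((S.path d).darts[i]).symm := rfl
  rcases S.eq_of_fst_eq_getVert d hi ((G.facePerm_fst _).trans h1) with h | h
  · have hs : G.rot.SameCycle ((S.path d).darts[i]).symm (S.path d).darts[i + 1] :=
      G.rot_cyclic _ _ (by rw [(S.darts_getElem d hi).1]; exact h1)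
    obtain ⟨n, hn⟩ := hs
    rw [← hn, h]
    exact (Function.IsFixedPt.perm_zpow (h2.symm.trans h) n).symm
  · exact h

/-- The first dart of the path that replaces a dart. -/
noncomputable def first : G.graph.Dart :=
  (S.path d).firstDart (S.not_nil d)

theorem first_eq_getElem :
    S.first d = (S.path d).darts[0]'(by
      rw [SimpleGraph.Walk.length_darts]; exact S.length_path_pos d) := by
  rw [first, ← SimpleGraph.Walk.head_darts_eq_firstDart
    (SimpleGraph.Walk.darts_eq_nil.not.2 (S.not_nil _)), List.head_eq_getElem]

theorem first_mem : S.first d ∈ (S.path d).darts := by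
  rw [first_eq_getElem]
  exact List.getElem_mem _

theorem faceOf_getElem {i : ℕ} (hi : i < (S.path d).darts.length) :
    G.faceOf (S.path d).darts[i] = G.faceOf (S.first d) := by
  induction i with
  | zero => rw [S.first_eq_getElem]
  | succ i ih => rw [← S.facePerm_getElem d hi, G.faceOf_facePerm, ih (by omega)]

variable {d} in
theorem faceOf_of_mem {g : G.graph.Dart} (hg : g ∈ (S.path d).darts) :
    G.faceOf g = G.faceOf (S.first d) := by
  obtain ⟨i, hi, rfl⟩ := List.getElem_of_mem hg
  exact S.faceOf_getElem d hi

/-- The last dart, reversed, is the first dart of the reversed path, so this is the condition on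
rotations at old vertices. Facial walks of `G` thus run along the paths in the order of the facial
walks of `R`. -/
theorem facePerm_lastDart :
    G.facePerm ((S.path d).lastDart (S.not_nil d)) = S.first (R.facePerm d) := by
  have h1 : ((S.path d).lastDart (S.not_nil d)).symm = S.first d.symm := by
    apply SimpleGraph.Dart.ext
    apply Prod.ext
    · rfl
    · have : (S.path d.symm).snd = (S.path d).penultimate := by
        rw [S.path_symm]
        exact SimpleGraph.Walk.snd_reverse _
      exact this.symm
  have h2 : G.facePerm ((S.path d).lastDart (S.not_nil d)) = G.rot (S.first d.symm) := by
    rw [← h1]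
    rfl
  rw [h2]
  exact S.rot_firstDart _ (S.not_nil _) (S.not_nil _)

theorem faceOf_first_facePerm : G.faceOf (S.first (R.facePerm d)) = G.faceOf (S.first d) := by
  rw [← facePerm_lastDart, G.faceOf_facePerm]
  apply S.faceOf_of_mem
  have h := S.length_path_pos d
  rw [SimpleGraph.Walk.lastDart_eq (S.not_nil d)
    (by rw [SimpleGraph.Walk.length_darts]; omega)]
  exact List.getElem_mem _

variable {d} in
theorem origFace_faceOf {g : G.graph.Dart} (hg : g ∈ (S.path d).darts) :
    S.origFace (G.faceOf g) = R.faceOf d :=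
  ((S.existsUnique_corresponds (G.faceOf g)).choose_spec.2 _ ⟨d, g, hg, rfl, rfl⟩).symm

/-- Different faces of the subdivision correspond to different faces of the original graph. -/
theorem eq_faceOf_first {f : G.Face} (h : S.origFace f = R.faceOf d) :
    f = G.faceOf (S.first d) := by
  obtain ⟨g, rfl⟩ : ∃ g, G.faceOf g = f := Quotient.exists_rep f
  obtain ⟨e, he⟩ := S.exists_path g
  rw [S.origFace_faceOf he] at h
  rw [S.faceOf_of_mem he]
  exact PlaneGraph.apply_eq_of_faceOf_eq (φ := fun d => G.faceOf (S.first d))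
    S.faceOf_first_facePerm h

/-- A dart leaving an old vertex is the first dart of its path, so it comes from a dart of `R`
leaving that vertex. -/
theorem incident_branch {x : V} {f : G.Face} :
    PlaneGraph.Incident (S.branch x) f ↔ PlaneGraph.Incident x (S.origFace f) := by
  constructor
  · rintro ⟨g, hg, rfl⟩
    obtain ⟨d, hd⟩ := S.exists_path g
    refine ⟨d, ?_, (S.origFace_faceOf hd).symm⟩
    obtain ⟨i, hi, rfl⟩ := List.getElem_of_mem hd
    have hl : (S.path d).darts.length = (S.path d).length := SimpleGraph.Walk.length_darts _
    rw [(S.darts_getElem d hi).1] at hg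
    rcases S.getVert_mem_range d (by omega) ⟨x, hg.symm⟩ with rfl | h
    · exact S.branch.injective (by rw [← hg]; simp)
    · omega
  · rintro ⟨d, rfl, hd⟩
    refine ⟨S.first d, rfl, (S.eq_faceOf_first d hd.symm).symm⟩

/-- The paths through a new vertex are those of `d` and `d.symm`. This is what turns a new vertex
into an edge of the multigraph on the faces of `R`. -/
theorem incident_of_notMem_range {w : W} {f : G.Face} {d : R.graph.Dart}
    (hw : w ∉ Set.range S.branch) (hd : w ∈ (S.path d).support) :
    PlaneGraph.Incident w f ↔ S.origFace f ∈ s(R.faceOf d, R.faceOf d.symm) := by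
  rw [Sym2.mem_iff]
  constructor
  · rintro ⟨g, rfl, rfl⟩
    obtain ⟨e, he⟩ := S.exists_path g
    rw [S.origFace_faceOf he]
    rcases S.eq_or_eq_symm hw hd (SimpleGraph.Walk.dart_fst_mem_support_of_mem_darts _ he)
      with rfl | rfl
    · exact Or.inl rfl
    · exact Or.inr rfl
  · have key : ∀ e : R.graph.Dart, w ∈ (S.path e).support → S.origFace f = R.faceOf e →
        PlaneGraph.Incident w f := by
      intro e he hf
      obtain ⟨i, rfl, hi⟩ := SimpleGraph.Walk.mem_support_iff_exists_getVert.1 he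
      have hi' : i < (S.path e).darts.length := by
        rw [SimpleGraph.Walk.length_darts]
        refine lt_of_le_of_ne hi ?_
        rintro rfl
        exact hw ⟨e.snd, by simp⟩
      exact ⟨(S.path e).darts[i], (S.darts_getElem e hi').1,
        (S.faceOf_getElem e hi').trans (S.eq_faceOf_first e hf).symm⟩
    rintro (h | h)
    · exact key d hd h
    · refine key d.symm ?_ h
      rwa [S.mem_support_symm]

theorem exists_mem_support {w : W} (hw : w ∉ Set.range S.branch) :
    ∃ d, w ∈ (S.path d).support :=
  (S.vertex_covered w).resolve_left hw

/-- The excess of a face is the number of new vertices incident with it. -/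
theorem faceDegree_eq [Finite W] (f : G.Face) :
    G.faceDegree f = R.faceDegree (S.origFace f) +
      {w : ((Set.range S.branch)ᶜ : Set W) | PlaneGraph.Incident w.1 f}.ncard := by
  have := Finite.of_injective _ S.branch.injective
  have h : {w : W | PlaneGraph.Incident w f} =
      S.branch '' {x | PlaneGraph.Incident x (S.origFace f)} ∪
        Subtype.val '' {w : ((Set.range S.branch)ᶜ : Set W) | PlaneGraph.Incident w.1 f} := by
    ext w
    constructor
    · intro hw
      by_cases h : w ∈ Set.range S.branch
      · obtain ⟨x, rfl⟩ := h
        exact Or.inl ⟨x, S.incident_branch.1 hw, rfl⟩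
      · exact Or.inr ⟨⟨w, h⟩, hw, rfl⟩
    · rintro (⟨x, hx, rfl⟩ | ⟨w, hw, rfl⟩)
      · exact S.incident_branch.2 hx
      · exact hw
  rw [PlaneGraph.faceDegree, h, Set.ncard_union_eq ?_ (Set.toFinite _) (Set.toFinite _),
    Set.ncard_image_of_injective _ S.branch.injective,
    Set.ncard_image_of_injective _ Subtype.val_injective]
  · rfl
  · rw [Set.disjoint_left]
    rintro _ ⟨x, _, rfl⟩ ⟨w, _, hw⟩
    exact w.2 ⟨x, hw.symm⟩

theorem le_maxExcess [Finite W] (f : G.Face) :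
    (G.faceDegree f : ℤ) - R.faceDegree (S.origFace f) ≤ S.maxExcess :=
  le_ciSup (f := fun f : G.Face => (G.faceDegree f : ℤ) - R.faceDegree (S.origFace f))
    (Set.finite_range _).bddAbove f

/-- A new vertex has degree `2`. -/
theorem ncard_neighborSet_getVert {i : ℕ} (hi : i + 1 < (S.path d).length) :
    (G.graph.neighborSet ((S.path d).getVert (i + 1))).ncard = 2 := by
  have hl : (S.path d).darts.length = (S.path d).length := SimpleGraph.Walk.length_darts _
  rw [Set.ncard_eq_two]
  refine ⟨(S.path d).getVert i, (S.path d).getVert (i + 2), ?_, ?_⟩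
  · intro h
    have := S.getVert_inj (by omega) (by omega) h
    omega
  · ext w
    simp only [SimpleGraph.mem_neighborSet, Set.mem_insert_iff, Set.mem_singleton_iff]
    constructor
    · intro h
      rcases S.eq_of_fst_eq_getVert d (i := i) (by omega) (k := ⟨(_, w), h⟩) rfl with h' | h'
      · exact Or.inl ((congrArg (fun k : G.graph.Dart => k.snd) h').trans
          (S.darts_getElem d (by omega)).1)
      · exact Or.inr ((congrArg (fun k : G.graph.Dart => k.snd) h').trans
          (S.darts_getElem d (by omega)).2)
    · rintro (rfl | rfl)
      · exact ((S.path d).adj_getVert_succ (by omega)).symm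
      · exact (S.path d).adj_getVert_succ (by omega)

/-- An edge is replaced by a path with at most `t(G)` inner vertices. -/
theorem length_path_le [Finite W] : (S.path d).length ≤ G.longestTwoPath + 1 := by
  rcases Nat.lt_or_ge (S.path d).length 2 with h | h
  · omega
  -- Without its two ends, the path has two edges fewer, and all its vertices have degree 2.
  have := PlaneGraph.length_lt_longestTwoPath (G := G)
    (p := ((S.path d).drop 1).take ((S.path d).length - 2))
    (((S.path_isPath d).drop 1).take _) ?_
  · rw [SimpleGraph.Walk.take_length, SimpleGraph.Walk.drop_length] at this
    omega
  · intro w hw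
    obtain ⟨i, rfl, hi⟩ := SimpleGraph.Walk.mem_support_iff_exists_getVert.1 hw
    rw [SimpleGraph.Walk.take_length, SimpleGraph.Walk.drop_length] at hi
    rw [SimpleGraph.Walk.take_getVert, SimpleGraph.Walk.drop_getVert, add_comm]
    exact S.ncard_neighborSet_getVert d (by omega)

theorem ncard_inner_le [Finite W] :
    {w : ((Set.range S.branch)ᶜ : Set W) | w.1 ∈ (S.path d).support}.ncard ≤ G.longestTwoPath := by
  classical
  have hsub : Subtype.val '' {w : ((Set.range S.branch)ᶜ : Set W) | w.1 ∈ (S.path d).support} ⊆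
      (Finset.Ico 1 (S.path d).length).image (S.path d).getVert := by
    rintro _ ⟨⟨w, hw⟩, hws, rfl⟩
    obtain ⟨i, rfl, hi⟩ := SimpleGraph.Walk.mem_support_iff_exists_getVert.1 hws
    simp only [Finset.coe_image, Finset.coe_Ico, Set.mem_image, Set.mem_Ico]
    refine ⟨i, ⟨?_, lt_of_le_of_ne hi ?_⟩, rfl⟩
    · rw [Nat.one_le_iff_ne_zero]
      rintro rfl
      exact hw ⟨d.fst, by simp⟩
    · rintro rfl
      exact hw ⟨d.snd, by simp⟩
  have h1 := Set.ncard_le_ncard hsub (Set.toFinite _)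
  rw [Set.ncard_image_of_injective _ Subtype.val_injective, Set.ncard_coe_finset] at h1
  have h2 := h1.trans Finset.card_image_le
  rw [Nat.card_Ico] at h2
  have := S.length_path_le d
  omega

open Classical in
/-- The upper bound on the cyclic chromatic number of a subdivision of a 3-connected plane graph. -/
theorem cyclicChromaticNumber_le [Finite V] [Finite W] (h3 : R.IsThreeConnected) :
    (G.cyclicChromaticNumber : ℤ)
      ≤ S.maxExcess + G.longestTwoPath + R.cyclicChromaticNumber := by
  obtain ⟨c, hc⟩ := R.exists_isCyclicColoring
  choose δ hδ using fun w : ((Set.range S.branch)ᶜ : Set W) => S.exists_mem_support w.2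
  -- Vizing's theorem takes a natural number `Δ`. The excess of a face counts new vertices, and a
  -- face exists because `R` has an edge.
  have hmax : 0 ≤ S.maxExcess := by
    have : Nontrivial V := Finite.one_lt_card_iff_nontrivial.1 (by have := h3.1; omega)
    obtain ⟨v⟩ := R.connected.nonempty
    obtain ⟨w, hw⟩ := R.connected.preconnected.exists_adj_of_nontrivial v
    have := S.le_maxExcess (G.faceOf (S.first ⟨(v, w), hw⟩))
    rw [S.faceDegree_eq] at this
    push_cast at this
    omega
  obtain ⟨Δ, hΔ⟩ := Int.eq_ofNat_of_zero_le hmax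
  -- The multigraph has the faces of `R` as vertices and the new vertices as edges. Degrees are
  -- excesses; parallel edges are inner vertices of the same path, since the dual is simple.
  obtain ⟨c', hc'⟩ := EdgeColoring.exists_coloring
    (ends := fun w => s(R.faceOf (δ w), R.faceOf (δ w).symm)) (Δ := Δ) (μ := G.longestTwoPath)
    (fun w h => h3.faceOf_ne_faceOf_symm _ (Sym2.mk_isDiag_iff.1 h)) (by
      intro φ
      obtain ⟨d, rfl⟩ : ∃ d, R.faceOf d = φ := Quotient.exists_rep φ
      have horig := S.origFace_faceOf (S.first_mem d)
      have hset : {w | R.faceOf d ∈ s(R.faceOf (δ w), R.faceOf (δ w).symm)} =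
          {w : ((Set.range S.branch)ᶜ : Set W) |
            PlaneGraph.Incident w.1 (G.faceOf (S.first d))} := by
        ext w
        exact (horig ▸ S.incident_of_notMem_range w.2 (hδ w)).symm
      have := S.le_maxExcess (G.faceOf (S.first d))
      rw [S.faceDegree_eq, hΔ] at this
      rw [hset]
      push_cast at this
      omega) (by
      intro w
      refine (Set.ncard_le_ncard ?_ (Set.toFinite _)).trans (S.ncard_inner_le (δ w))
      intro w' hw'
      have := hδ w'
      rcases (SimpleGraph.dart_edge_eq_iff _ _).1 (h3.edge_eq_of_faces_eq _ _ hw') with h | h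
      · rw [h] at this
        exact this
      · rwa [h, S.mem_support_symm] at this)
  -- The disjoint palettes settle all pairs of an old and a new vertex.
  let C : W → Fin (Δ + G.longestTwoPath) ⊕ Fin R.cyclicChromaticNumber := fun w =>
    if h : w ∈ Set.range S.branch then Sum.inr (c h.choose) else Sum.inl (c' ⟨w, h⟩)
  have hC : G.IsCyclicColoring C := by
    intro f x y hx hy hxy
    by_cases hx' : x ∈ Set.range S.branch <;> by_cases hy' : y ∈ Set.range S.branch
    · simp only [C, dif_pos hx', dif_pos hy', ne_eq, Sum.inr.injEq]
      have ex := hx'.choose_spec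
      have ey := hy'.choose_spec
      refine hc (S.origFace f) _ _ (S.incident_branch.1 (ex.symm ▸ hx))
        (S.incident_branch.1 (ey.symm ▸ hy)) fun h => hxy ?_
      rw [← ex, ← ey, h]
    · simp only [C, dif_pos hx', dif_neg hy', ne_eq, reduceCtorEq, not_false_eq_true]
    · simp only [C, dif_neg hx', dif_pos hy', ne_eq, reduceCtorEq, not_false_eq_true]
    · simp only [C, dif_neg hx', dif_neg hy', ne_eq, Sum.inl.injEq]
      exact hc' ⟨x, hx'⟩ ⟨y, hy'⟩ (fun h => hxy (congrArg Subtype.val h)) (S.origFace f)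
        ((S.incident_of_notMem_range hx' (hδ ⟨x, hx'⟩)).1 hx)
        ((S.incident_of_notMem_range hy' (hδ ⟨y, hy'⟩)).1 hy)
  have := PlaneGraph.cyclicChromaticNumber_le hC
  rw [Nat.card_eq_fintype_card, Fintype.card_sum, Fintype.card_fin, Fintype.card_fin] at this
  rw [hΔ]
  exact_mod_cast this

end PlaneSubdivision

/-! ### The spiders as plane graphs -/

theorem Equiv.Perm.SameCycle.permCongr {α β : Type*} {p : Equiv.Perm α} {a b : α} (e : α ≃ β)
    (h : p.SameCycle a b) : (e.permCongr p).SameCycle (e a) (e b) := by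
  obtain ⟨n, rfl⟩ := h
  refine ⟨n, ?_⟩
  have : e.permCongr p ^ n = e.permCongr (p ^ n) := (map_zpow e.permCongrHom p n).symm
  rw [this, Equiv.permCongr_apply, Equiv.symm_apply_apply]

/-- Here `φ` is a complete invariant of the cycles and `ψ` picks representatives; the faces of a
spider are counted this way. -/
theorem Equiv.Perm.card_quotient_sameCycle {α β : Type*} {p : Equiv.Perm α} {φ : α → β} {ψ : β → α}
    (hφ : ∀ a, φ (p a) = φ a) (hψ : ∀ a, p.SameCycle a (ψ (φ a))) (hφψ : ∀ b, φ (ψ b) = b) :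
    Nat.card (Quotient (Equiv.Perm.SameCycle.setoid p)) = Nat.card β := by
  refine Nat.card_congr ⟨Quotient.lift φ fun a b h => ?_,
    fun b => Quotient.mk (Equiv.Perm.SameCycle.setoid p) (ψ b), ?_, hφψ⟩
  · exact Equiv.Perm.SameCycle.apply_eq_of_invariant hφ h
  · rintro ⟨a⟩
    exact Quotient.sound (hψ a).symm

/-- The darts of a spider: each of its three legs, whose vertices are numbered from `0` to `t`, is
traversed outwards by the darts `out` and inwards by the darts `inn`, and the ends of the legs are
joined by a triangle, traversed by the darts `ccw` and `cw`. -/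
inductive SpiderDart (t : ℕ) : Type
  | out (i : ZMod 3) (j : Fin (t + 1))
  | inn (i : ZMod 3) (j : Fin (t + 1))
  | ccw (i : ZMod 3)
  | cw (i : ZMod 3)

namespace SpiderDart

variable {t : ℕ}

/-- The vertex before the vertex `j` of the leg `i`; `none` is the center. -/
def inner (i : ZMod 3) (j : Fin (t + 1)) : Option (ZMod 3 × Fin (t + 1)) :=
  Fin.cases none (fun k => some (i, k.castSucc)) j

@[simp]
theorem inner_zero (i : ZMod 3) : inner i (0 : Fin (t + 1)) = none := rfl

@[simp]
theorem inner_succ (i : ZMod 3) (k : Fin t) : inner i k.succ = some (i, k.castSucc) := rfl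

theorem inner_eq_some {i i' : ZMod 3} {j k : Fin (t + 1)} :
    inner i j = some (i', k) ↔ i = i' ∧ (k : ℕ) + 1 = j := by
  induction j using Fin.cases with
  | zero => simp
  | succ j =>
    simp only [inner_succ, Option.some.injEq, Prod.mk.injEq, Fin.ext_iff, Fin.val_castSucc,
      Fin.val_succ]
    refine and_congr_right fun _ => ?_
    omega

/-- The vertex that a dart leaves. -/
def src : SpiderDart t → Option (ZMod 3 × Fin (t + 1))
  | out i j => inner i j
  | inn i j => some (i, j)
  | ccw i => some (i, Fin.last t)
  | cw i => some (i + 1, Fin.last t)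

/-- The reversed dart. -/
def rev : SpiderDart t → SpiderDart t
  | out i j => inn i j
  | inn i j => out i j
  | ccw i => cw i
  | cw i => ccw i

theorem rev_rev (d : SpiderDart t) : d.rev.rev = d := by
  cases d <;> rfl

theorem inner_ne (i i' : ZMod 3) (j : Fin (t + 1)) : inner i j ≠ some (i', j) := by
  rw [Ne, inner_eq_some]
  omega

theorem src_ne_src_rev (d : SpiderDart t) : d.src ≠ d.rev.src := by
  cases d with
  | out i j => exact inner_ne i i j
  | inn i j => exact (inner_ne i i j).symm
  | ccw i => simp [src, rev]
  | cw i => simp [src, rev]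

theorem inner_ne_last (i i' : ZMod 3) (j : Fin (t + 1)) : inner i j ≠ some (i', Fin.last t) := by
  rw [Ne, inner_eq_some, Fin.val_last]
  omega

theorem ext_src {d e : SpiderDart t} (h : d.src = e.src) (h' : d.rev.src = e.rev.src) : d = e := by
  -- The ends of the legs form a triangle and not a digon, so `ccw` and `cw` darts never have the
  -- same ends in the same order.
  have h3 : ∀ i i' : ZMod 3, i = i' + 1 → i + 1 ≠ i' := by decide
  have hkey : ∀ (i i' : ZMod 3) (j j' : Fin (t + 1)), inner i j = some (i', j') →
      some (i, j) ≠ inner i' j' := by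
    intro i i' j j' h h'
    have h1 := (inner_eq_some.1 h).2
    have h2 := (inner_eq_some.1 h'.symm).2
    omega
  cases d <;> cases e <;> simp only [src, rev] at h h' <;>
    first
    | (simp only [Option.some.injEq, Prod.mk.injEq, and_true, add_left_inj] at h h'
       grind)
    | exact absurd h' (hkey _ _ _ _ h)
    | exact absurd h'.symm (hkey _ _ _ _ h.symm)
    | exact absurd h (inner_ne_last _ _ _)
    | exact absurd h' (inner_ne_last _ _ _)
    | exact absurd h.symm (inner_ne_last _ _ _)
    | exact absurd h'.symm (inner_ne_last _ _ _)

/-- The dart that follows a dart in the counterclockwise order around the vertex that it leaves. -/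
def rot : Equiv.Perm (SpiderDart t) where
  -- The center has the cycle of the darts `out i 0`, the end of the leg `i` the cycle `inn i
  -- (Fin.last t)`, `cw (i - 1)`, `ccw i`; at every other vertex the two darts are exchanged.
  toFun
    | out i j => Fin.cases (out (i + 1) 0) (fun k => inn i k.castSucc) j
    | inn i j => Fin.lastCases (cw (i - 1)) (fun k => out i k.succ) j
    | ccw i => inn i (Fin.last t)
    | cw i => ccw (i + 1)
  invFun
    | out i j => Fin.cases (out (i - 1) 0) (fun k => inn i k.castSucc) j
    | inn i j => Fin.lastCases (ccw i) (fun k => out i k.succ) j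
    | ccw i => cw (i - 1)
    | cw i => inn (i + 1) (Fin.last t)
  left_inv d := by
    cases d with
    | out i j => cases j using Fin.cases <;> simp
    | inn i j => cases j using Fin.lastCases <;> simp
    | ccw i => simp
    | cw i => simp
  right_inv d := by
    cases d with
    | out i j => cases j using Fin.cases <;> simp
    | inn i j => cases j using Fin.lastCases <;> simp
    | ccw i => simp
    | cw i => simp

theorem rot_out_zero (i : ZMod 3) : rot (out i 0 : SpiderDart t) = out (i + 1) 0 := rfl

theorem rot_out_succ (i : ZMod 3) (k : Fin t) : rot (out i k.succ) = inn i k.castSucc := rfl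

theorem rot_inn_last (i : ZMod 3) : rot (inn i (Fin.last t)) = cw (i - 1) := by
  simp [rot]

theorem rot_inn_castSucc (i : ZMod 3) (k : Fin t) : rot (inn i k.castSucc) = out i k.succ := by
  simp [rot]

theorem src_rot (d : SpiderDart t) : (rot d).src = d.src := by
  cases d with
  | out i j => cases j using Fin.cases <;> rfl
  | inn i j =>
    cases j using Fin.lastCases with
    | last => simp [rot_inn_last, src]
    | cast k => rw [rot_inn_castSucc]; rfl
  | ccw i => rfl
  | cw i => rfl

/-- The face to which a dart belongs: the face between the legs `i` and `i + 1`, or the outer face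
`none`. -/
def label : SpiderDart t → Option (ZMod 3)
  | out i _ => some (i - 1)
  | inn i _ => some i
  | ccw _ => none
  | cw i => some i

theorem label_rot_rev (d : SpiderDart t) : (rot d.rev).label = d.label := by
  cases d with
  | out i j =>
    cases j using Fin.lastCases with
    | last => simp [rev, rot_inn_last, label]
    | cast k => simp [rev, rot_inn_castSucc, label]
  | inn i j =>
    cases j using Fin.cases with
    | zero => simp [rev, rot_out_zero, label]
    | succ k => simp [rev, rot_out_succ, label]
  | ccw i => rfl
  | cw i => rfl

/-- The reversal of darts as a permutation. -/
def revPerm : Equiv.Perm (SpiderDart t) := Function.Involutive.toPerm rev rev_rev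

theorem eq_or_eq_add (i i' : ZMod 3) : i' = i ∨ i' = i + 1 ∨ i' = i + 1 + 1 := by
  revert i i'
  decide

theorem sameCycle_of_add_one {p : Equiv.Perm (SpiderDart t)} {f : ZMod 3 → SpiderDart t}
    (h : ∀ i, p (f i) = f (i + 1)) (i i' : ZMod 3) : p.SameCycle (f i) (f i') := by
  have h1 : ∀ i, p.SameCycle (f i) (f (i + 1)) := fun i =>
    h i ▸ (Equiv.Perm.SameCycle.refl p _).apply_right
  rcases eq_or_eq_add i i' with rfl | rfl | rfl
  · exact Equiv.Perm.SameCycle.refl _ _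
  · exact h1 i
  · exact (h1 i).trans (h1 _)

/-- A dart that leaves a given vertex. -/
def ofSrc : Option (ZMod 3 × Fin (t + 1)) → SpiderDart t
  | none => out 0 0
  | some (i, j) => inn i j

theorem sameCycle_rot (d : SpiderDart t) : rot.SameCycle d (ofSrc d.src) := by
  cases d with
  | out i j =>
    cases j using Fin.cases with
    | zero => exact sameCycle_of_add_one (f := fun i => out i 0) rot_out_zero i 0
    | succ k => exact (Equiv.Perm.SameCycle.refl rot _).apply_right
  | inn i j => exact Equiv.Perm.SameCycle.refl _ _
  | ccw i => exact (Equiv.Perm.SameCycle.refl rot _).apply_right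
  | cw i => exact (Equiv.Perm.SameCycle.refl rot _).apply_right.apply_right

/-- A dart of a given face. -/
def ofLabel : Option (ZMod 3) → SpiderDart t
  | none => ccw 0
  | some i => inn i 0

theorem label_ofLabel (l : Option (ZMod 3)) : (ofLabel l : SpiderDart t).label = l := by
  cases l <;> rfl

/-- The walk around the face `i` goes out along the leg `i + 1`, crosses by `cw i`, and comes in
along the leg `i`; `inn i 0` is its step into the center. The outer walk consists of the darts
`ccw`. -/
theorem sameCycle_facePerm (d : SpiderDart t) :
    Equiv.Perm.SameCycle (revPerm.trans rot) d (ofLabel d.label) := by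
  set p : Equiv.Perm (SpiderDart t) := revPerm.trans rot
  have hp : ∀ d, p.SameCycle d (rot d.rev) := fun d =>
    (Equiv.Perm.SameCycle.refl p d).apply_right
  have hinn : ∀ (i : ZMod 3) (j : Fin (t + 1)), p.SameCycle (inn i j) (inn i 0) := by
    intro i j
    induction j using Fin.induction with
    | zero => exact Equiv.Perm.SameCycle.refl _ _
    | succ k ih => exact (hp (inn i k.succ)).trans ih
  have hcw : ∀ i, p.SameCycle (cw i) (inn i 0) := fun i => (hp (cw i)).trans (hinn i _)
  cases d with
  | out i j =>
    have hout : p.SameCycle (out i j) (inn (i - 1) 0) := by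
      induction j using Fin.reverseInduction with
      | last =>
        have := hp (out i (Fin.last t))
        rw [rev, rot_inn_last] at this
        exact this.trans (hcw _)
      | cast k ih =>
        have := hp (out i k.castSucc)
        rw [rev, rot_inn_castSucc] at this
        exact this.trans ih
    exact hout
  | inn i j => exact hinn i j
  | ccw i => exact sameCycle_of_add_one (p := p) (f := ccw) (fun _ => rfl) i 0
  | cw i => exact hcw i

/-- The darts of a spider are its edges with a direction. -/
def equivSum : SpiderDart t ≃ ((ZMod 3 × Fin (t + 1)) ⊕ ZMod 3) × Bool where
  toFun
    | out i j => (Sum.inl (i, j), true)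
    | inn i j => (Sum.inl (i, j), false)
    | ccw i => (Sum.inr i, true)
    | cw i => (Sum.inr i, false)
  invFun
    | (Sum.inl (i, j), true) => out i j
    | (Sum.inl (i, j), false) => inn i j
    | (Sum.inr i, true) => ccw i
    | (Sum.inr i, false) => cw i
  left_inv d := by cases d <;> rfl
  right_inv := by rintro ⟨⟨i, j⟩ | i, _ | _⟩ <;> rfl

theorem card_eq : Nat.card (SpiderDart t) = 2 * (3 * t + 6) := by
  rw [Nat.card_congr equivSum]
  simp [Nat.card_eq_fintype_card, ZMod.card]
  ring

/-- The spider as a graph. -/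
def graph (t : ℕ) : SimpleGraph (Option (ZMod 3 × Fin (t + 1))) where
  Adj v w := ∃ d : SpiderDart t, d.src = v ∧ d.rev.src = w
  symm := ⟨fun _ _ ⟨d, h, h'⟩ => ⟨d.rev, h', by rw [rev_rev, h]⟩⟩
  loopless := ⟨fun _ ⟨d, h, h'⟩ => d.src_ne_src_rev (h.trans h'.symm)⟩

theorem adj (d : SpiderDart t) : (graph t).Adj d.src d.rev.src := ⟨d, rfl, rfl⟩

/-- The darts of the spider are the darts of its graph. -/
noncomputable def equivDart : SpiderDart t ≃ (graph t).Dart :=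
  Equiv.ofBijective (fun d => ⟨(d.src, d.rev.src), d.adj⟩)
    ⟨fun _ _ h => ext_src (congrArg (fun k : (graph t).Dart => k.fst) h)
      (congrArg (fun k : (graph t).Dart => k.snd) h), fun ⟨_, d, h, h'⟩ => ⟨d, by
        apply SimpleGraph.Dart.ext
        exact Prod.ext h h'⟩⟩

theorem equivDart_fst (d : SpiderDart t) : (equivDart d).fst = d.src := rfl

theorem equivDart_snd (d : SpiderDart t) : (equivDart d).snd = d.rev.src := rfl

theorem equivDart_symm (d : SpiderDart t) : (equivDart d).symm = equivDart d.rev := by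
  apply SimpleGraph.Dart.ext
  refine Prod.ext rfl ?_
  exact congrArg src (rev_rev d).symm

theorem adj_zero (i : ZMod 3) : (graph t).Adj none (some (i, ⟨0, by omega⟩)) :=
  adj (out i 0)

theorem adj_succ (i : ZMod 3) (n : ℕ) (h : n + 1 < t + 1) :
    (graph t).Adj (some (i, ⟨n, by omega⟩)) (some (i, ⟨n + 1, h⟩)) :=
  adj (out i ⟨n + 1, h⟩)

/-- The initial part of a leg, from the center. -/
def leg (i : ZMod 3) : ∀ (n : ℕ) (h : n < t + 1), (graph t).Walk none (some (i, ⟨n, h⟩))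
  | 0, _ => SimpleGraph.Walk.cons (adj_zero i) SimpleGraph.Walk.nil
  | n + 1, h => (leg i n (by omega)).concat (adj_succ i n h)

theorem mem_support_leg {i : ZMod 3} {n : ℕ} {h : n < t + 1}
    {w : Option (ZMod 3 × Fin (t + 1))} :
    w ∈ (leg i n h).support ↔ w = none ∨ ∃ k : Fin (t + 1), (k : ℕ) ≤ n ∧ w = some (i, k) := by
  induction n with
  | zero =>
    simp only [leg, SimpleGraph.Walk.support_cons, SimpleGraph.Walk.support_nil, List.mem_cons,
      List.not_mem_nil, or_false]
    refine or_congr Iff.rfl ⟨fun h => ⟨0, le_rfl, h⟩, ?_⟩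
    rintro ⟨k, hk, rfl⟩
    rw [show k = ⟨0, h⟩ from Fin.ext (Nat.le_zero.1 hk)]
  | succ n ih =>
    simp only [leg, SimpleGraph.Walk.support_concat, List.mem_append, List.mem_singleton, ih]
    constructor
    · rintro ((h | ⟨k, hk, rfl⟩) | rfl)
      · exact Or.inl h
      · exact Or.inr ⟨k, by omega, rfl⟩
      · exact Or.inr ⟨⟨n + 1, h⟩, le_rfl, rfl⟩
    · rintro (h | ⟨k, hk, rfl⟩)
      · exact Or.inl (Or.inl h)
      · rcases Nat.le_succ_iff.1 hk with hk | hk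
        · exact Or.inl (Or.inr ⟨k, hk, rfl⟩)
        · exact Or.inr (by rw [show k = ⟨n + 1, h⟩ from Fin.ext hk])

theorem isPath_leg (i : ZMod 3) (n : ℕ) (h : n < t + 1) : (leg i n h).IsPath := by
  induction n with
  | zero => exact SimpleGraph.Walk.IsPath.nil.cons (by simp)
  | succ n ih =>
    refine (ih _).concat ?_ _
    rw [mem_support_leg]
    rintro (h | ⟨k, hk, h⟩)
    · exact Option.some_ne_none _ h
    · have h : (⟨n + 1, _⟩ : Fin (t + 1)) = k := congrArg Prod.snd (Option.some.inj h)
      rw [← h] at hk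
      exact absurd hk (by simp)

theorem mem_edges_leg (i : ZMod 3) (n : ℕ) (h : n < t + 1) (j : Fin (t + 1)) (hj : (j : ℕ) ≤ n) :
    s(inner i j, some (i, j)) ∈ (leg i n h).edges := by
  induction n with
  | zero =>
    obtain rfl : j = ⟨0, h⟩ := Fin.ext (Nat.le_zero.1 hj)
    simp only [leg, SimpleGraph.Walk.edges_cons, SimpleGraph.Walk.edges_nil, List.mem_singleton]
    rfl
  | succ n ih =>
    simp only [leg, SimpleGraph.Walk.edges_concat, List.concat_eq_append, List.mem_append,
      List.mem_singleton]
    rcases Nat.le_succ_iff.1 hj with hj | hj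
    · exact Or.inl (ih _ hj)
    · right
      rw [show j = ⟨n + 1, h⟩ from Fin.ext hj]
      rfl

theorem connected_graph (t : ℕ) : (graph t).Connected := by
  have : ∀ v, (graph t).Reachable none v := by
    rintro (_ | ⟨i, ⟨n, h⟩⟩)
    · exact SimpleGraph.Reachable.refl _
    · exact ⟨leg i n h⟩
  exact ⟨fun v w => (this v).symm.trans (this w)⟩

theorem card_edgeSet (t : ℕ) : Nat.card (graph t).edgeSet = 3 * t + 6 := by
  classical
  have := (graph t).dart_card_eq_twice_card_edges
  rw [← Nat.card_eq_fintype_card, ← Nat.card_congr equivDart, card_eq,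
    SimpleGraph.edgeFinset_card, ← Nat.card_eq_fintype_card] at this
  omega

end SpiderDart

open SpiderDart in
theorem SpiderDart.permCongr_facePerm (t : ℕ) :
    (SimpleGraph.Dart.symm_involutive (G := graph t)).toPerm.trans (equivDart.permCongr rot) =
      equivDart.permCongr (revPerm.trans rot) := by
  ext1 d
  obtain ⟨d, rfl⟩ := equivDart.surjective d
  simp only [Equiv.trans_apply, Equiv.permCongr_apply, Function.Involutive.coe_toPerm,
    equivDart_symm, Equiv.symm_apply_apply]
  rfl

open SpiderDart in
/-- The spider with legs of `t + 1` vertices as a plane graph. -/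
noncomputable def spider (t : ℕ) : PlaneGraph (Option (ZMod 3 × Fin (t + 1))) where
  graph := SpiderDart.graph t
  rot := equivDart.permCongr rot
  rot_fst d := by
    obtain ⟨d, rfl⟩ := equivDart.surjective d
    rw [Equiv.permCongr_apply, Equiv.symm_apply_apply, equivDart_fst, equivDart_fst, src_rot]
  rot_cyclic d e h := by
    obtain ⟨d, rfl⟩ := equivDart.surjective d
    obtain ⟨e, rfl⟩ := equivDart.surjective e
    rw [equivDart_fst, equivDart_fst] at h
    exact ((sameCycle_rot d).trans (h ▸ (sameCycle_rot e).symm)).permCongr _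
  connected := connected_graph t
  -- The count is `(3t + 4) - (3t + 6) + 4 = 2`, with one face for each label.
  euler := by
    rw [card_edgeSet, permCongr_facePerm, Equiv.Perm.card_quotient_sameCycle
      (φ := fun d => (equivDart.symm d).label) (ψ := fun l => equivDart (ofLabel l))]
    · simp [Nat.card_eq_fintype_card, ZMod.card]
      ring
    · intro d
      obtain ⟨d, rfl⟩ := equivDart.surjective d
      rw [Equiv.permCongr_apply, Equiv.symm_apply_apply, Equiv.symm_apply_apply]
      exact label_rot_rev d
    · intro d
      obtain ⟨d, rfl⟩ := equivDart.surjective d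
      rw [Equiv.symm_apply_apply]
      exact (sameCycle_facePerm d).permCongr _
    · intro l
      rw [Equiv.symm_apply_apply, label_ofLabel]

/-! ### Spiders as subdivisions of the complete graph on four vertices -/

theorem SimpleGraph.Walk.firstDart_eq_of_snd_eq {V : Type*} {G : SimpleGraph V} {u v : V}
    {p : G.Walk u v} (h : ¬ p.Nil) {k : G.Dart} (hu : u = k.fst) (hs : p.snd = k.snd) :
    p.firstDart h = k := by
  apply SimpleGraph.Dart.ext
  exact Prod.ext hu hs

namespace SpiderDart

variable {t : ℕ}

theorem length_leg (i : ZMod 3) (n : ℕ) (h : n < t + 1) : (leg i n h).length = n + 1 := by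
  induction n with
  | zero => rfl
  | succ n ih => rw [leg, SimpleGraph.Walk.length_concat, ih]

theorem snd_leg (i : ZMod 3) (n : ℕ) (h : n < t + 1) : (leg i n h).snd = some (i, 0) := by
  induction n with
  | zero => rfl
  | succ n ih =>
    rw [leg, SimpleGraph.Walk.snd, SimpleGraph.Walk.concat_eq_append,
      SimpleGraph.Walk.getVert_append, length_leg]
    rcases Nat.eq_zero_or_pos n with rfl | hn
    · rfl
    · rw [if_pos (by omega)]
      exact ih _

theorem penultimate_leg (i : ZMod 3) (n : ℕ) (h : n < t + 1) :
    (leg i n h).penultimate = inner i ⟨n, h⟩ := by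
  cases n with
  | zero => rfl
  | succ n => exact SimpleGraph.Walk.penultimate_concat _ _

/-- The center and the ends of the legs. -/
def branch (t : ℕ) : Option (ZMod 3 × Fin 1) ↪ Option (ZMod 3 × Fin (t + 1)) where
  toFun := Option.map fun p => (p.1, Fin.last t)
  inj' := Option.map_injective fun _ _ h =>
    Prod.ext (congrArg (fun r => r.1) h) (Subsingleton.elim _ _)

theorem branch_none : branch t none = none := rfl

/-- This does not hold by computation for a variable `j`, so the ends of the replacing paths agree
with the images of the old ends only after rewriting. Hence `path` carries its ends along, and
`dartPath` transports them. -/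
theorem inner_fin_one (i : ZMod 3) (j : Fin 1) : inner (t := 0) i j = none := by
  rw [Subsingleton.elim j 0, inner_zero]

/-- The path that replaces a dart of the spider with legs of one vertex. -/
def path : SpiderDart 0 → Σ u v, (graph t).Walk u v
  | out i _ => ⟨_, _, leg i t (by omega)⟩
  | inn i _ => ⟨_, _, (leg i t (by omega)).reverse⟩
  | ccw i => ⟨_, _, SimpleGraph.Walk.cons (adj (ccw i)) SimpleGraph.Walk.nil⟩
  | cw i => ⟨_, _, SimpleGraph.Walk.cons (adj (cw i)) SimpleGraph.Walk.nil⟩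

theorem path_start (d : SpiderDart 0) : (path (t := t) d).1 = branch t d.src := by
  cases d with
  | out i j => rw [src, inner_fin_one]; rfl
  | inn i j => rfl
  | ccw i => rfl
  | cw i => rfl

theorem path_end (d : SpiderDart 0) : (path (t := t) d).2.1 = branch t d.rev.src := by
  cases d with
  | out i j => rfl
  | inn i j => rw [rev, src, inner_fin_one]; rfl
  | ccw i => rfl
  | cw i => rfl

theorem isPath_path (d : SpiderDart 0) : (path (t := t) d).2.2.IsPath := by
  have hcons : ∀ d : SpiderDart t,
      (SimpleGraph.Walk.cons d.adj SimpleGraph.Walk.nil).IsPath := by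
    intro d
    refine SimpleGraph.Walk.IsPath.nil.cons ?_
    rw [SimpleGraph.Walk.support_nil, List.mem_singleton]
    exact d.adj.ne
  cases d with
  | out i j => exact isPath_leg _ _ _
  | inn i j => exact (isPath_leg _ _ _).reverse
  | ccw i => exact hcons _
  | cw i => exact hcons _

theorem support_path_rev (d : SpiderDart 0) :
    (path (t := t) d.rev).2.2.support = (path (t := t) d).2.2.support.reverse := by
  cases d with
  | out i j => exact SimpleGraph.Walk.support_reverse _
  | inn i j =>
    refine Eq.trans ?_ (congrArg List.reverse (SimpleGraph.Walk.support_reverse _)).symm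
    rw [List.reverse_reverse]
    rfl
  | ccw i => rfl
  | cw i => rfl

/-- The vertices of the path that replaces a dart. -/
def OnPath : SpiderDart 0 → Option (ZMod 3 × Fin (t + 1)) → Prop
  | out i _, w => w = none ∨ ∃ k, w = some (i, k)
  | inn i _, w => w = none ∨ ∃ k, w = some (i, k)
  | ccw i, w => w = some (i, Fin.last t) ∨ w = some (i + 1, Fin.last t)
  | cw i, w => w = some (i, Fin.last t) ∨ w = some (i + 1, Fin.last t)

theorem mem_support_path {d : SpiderDart 0} {w : Option (ZMod 3 × Fin (t + 1))} :
    w ∈ (path d).2.2.support ↔ OnPath d w := by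
  have hleg : ∀ i : ZMod 3, w ∈ (leg i t (by omega)).support ↔ w = none ∨ ∃ k, w = some (i, k) := by
    intro i
    rw [mem_support_leg]
    exact or_congr Iff.rfl (exists_congr fun k => and_iff_right (by omega))
  have hcons : ∀ d : SpiderDart t, w ∈ (SimpleGraph.Walk.cons d.adj SimpleGraph.Walk.nil).support ↔
      w = d.src ∨ w = d.rev.src := by
    intro d
    rw [SimpleGraph.Walk.support_cons, SimpleGraph.Walk.support_nil, List.mem_cons,
      List.mem_singleton]
  cases d with
  | out i j => exact hleg i
  | inn i j =>
    refine Iff.trans ?_ (hleg i)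
    rw [← List.mem_reverse (as := (leg i t _).support), ← SimpleGraph.Walk.support_reverse]
    rfl
  | ccw i => exact hcons _
  | cw i => exact (hcons _).trans or_comm

theorem eq_src_of_onPath_branch {d : SpiderDart 0} {x : Option (ZMod 3 × Fin 1)}
    (h : OnPath d (branch t x)) : x = d.src ∨ x = d.rev.src := by
  have hsome : ∀ (x : Option (ZMod 3 × Fin 1)) (i : ZMod 3) (k : Fin (t + 1)) (j : Fin 1),
      branch t x = some (i, k) → x = some (i, j) := by
    rintro (_ | ⟨i', j'⟩) i k j h
    · exact nomatch h
    · rw [show i' = i from congrArg Prod.fst (Option.some.inj h), Subsingleton.elim j' j]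
  have hleg : ∀ (i : ZMod 3) (j : Fin 1), (branch t x = none ∨ ∃ k, branch t x = some (i, k)) →
      x = inner (t := 0) i j ∨ x = some (i, j) := by
    rintro i j (h | ⟨k, h⟩)
    · exact Or.inl ((branch t).injective (h.trans (by rw [inner_fin_one, branch_none])))
    · exact Or.inr (hsome x i k j h)
  cases d with
  | out i j => exact hleg i j h
  | inn i j => exact (hleg i j h).symm
  | ccw i => exact h.imp (hsome x _ _ _) (hsome x _ _ _)
  | cw i => exact (h.imp (hsome x _ _ _) (hsome x _ _ _)).symm

theorem mem_range_branch_of_onPath {d e : SpiderDart 0} {w : Option (ZMod 3 × Fin (t + 1))}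
    (hd : OnPath d w) (he : OnPath e w) (h : s(d.src, d.rev.src) ≠ s(e.src, e.rev.src)) :
    w ∈ Set.range (branch t) := by
  have hnone : w = none → w ∈ Set.range (branch t) := fun h => ⟨none, h.symm⟩
  have hlast : ∀ i : ZMod 3, w = some (i, Fin.last t) → w ∈ Set.range (branch t) :=
    fun i h => ⟨some (i, 0), h.symm⟩
  have hrim : ∀ i : ZMod 3, (w = some (i, Fin.last t) ∨ w = some (i + 1, Fin.last t)) →
      w ∈ Set.range (branch t) := fun i h => h.elim (hlast _) (hlast _)
  have hleg : ∀ i i' : ZMod 3, i ≠ i' → (w = none ∨ ∃ k, w = some (i, k)) →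
      (w = none ∨ ∃ k, w = some (i', k)) → w ∈ Set.range (branch t) := by
    rintro i i' hne (h | ⟨k, rfl⟩) h'
    · exact hnone h
    · rcases h' with h' | ⟨k', h'⟩
      · exact hnone h'
      · exact absurd (congrArg Prod.fst (Option.some.inj h')) hne
  cases d <;> cases e <;>
    first
    | exact hrim _ hd
    | exact hrim _ he
    | (refine hleg _ _ ?_ hd he
       rintro rfl
       apply h
       simp only [src, rev, inner_fin_one]
       simp [Subsingleton.elim (_ : Fin 1) 0, Sym2.eq_swap])

theorem exists_mem_edges_path (d : SpiderDart t) :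
    ∃ e : SpiderDart 0, s(d.src, d.rev.src) ∈ (path (t := t) e).2.2.edges := by
  have hleg : ∀ (i : ZMod 3) (j : Fin (t + 1)),
      s(inner i j, some (i, j)) ∈ (path (t := t) (out i 0)).2.2.edges :=
    fun i j => mem_edges_leg i t _ j (by omega)
  cases d with
  | out i j => exact ⟨out i 0, hleg i j⟩
  | inn i j => exact ⟨out i 0, Sym2.eq_swap ▸ hleg i j⟩
  | ccw i => exact ⟨ccw i, List.mem_singleton.2 rfl⟩
  | cw i => exact ⟨cw i, List.mem_singleton.2 rfl⟩

/-- The first dart of the path that replaces a dart. -/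
def corner : SpiderDart 0 → SpiderDart t
  | out i _ => out i 0
  | inn i _ => inn i (Fin.last t)
  | ccw i => ccw i
  | cw i => cw i

theorem path_start_eq_src_corner (d : SpiderDart 0) :
    (path (t := t) d).1 = (corner d : SpiderDart t).src := by
  cases d <;> rfl

theorem snd_path (d : SpiderDart 0) :
    (path (t := t) d).2.2.snd = (corner d : SpiderDart t).rev.src := by
  cases d with
  | out i j => exact snd_leg _ _ _
  | inn i j => exact (SimpleGraph.Walk.snd_reverse _).trans (penultimate_leg _ _ _)
  | ccw i => rfl
  | cw i => rfl

/-- At the center and the leg ends the rotation does not depend on the length of the legs; this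
gives the condition that the drawing is kept. -/
theorem rot_corner (d : SpiderDart 0) : rot (corner d : SpiderDart t) = corner (rot d) := by
  cases d with
  | out i j =>
    obtain rfl : j = 0 := Subsingleton.elim (α := Fin 1) _ _
    rfl
  | inn i j =>
    obtain rfl : j = Fin.last 0 := Subsingleton.elim (α := Fin 1) _ _
    rw [corner, rot_inn_last, rot_inn_last]
    rfl
  | ccw i => rfl
  | cw i => rfl

theorem equivDart_symm_src (d : (graph t).Dart) : (equivDart.symm d).src = d.fst := by
  rw [← equivDart_fst, Equiv.apply_symm_apply]

theorem equivDart_symm_rev_src (d : (graph t).Dart) : (equivDart.symm d).rev.src = d.snd := by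
  rw [← equivDart_snd, Equiv.apply_symm_apply]

theorem equivDart_symm_symm (d : (graph t).Dart) :
    equivDart.symm d.symm = (equivDart.symm d).rev := by
  rw [Equiv.symm_apply_eq, ← equivDart_symm, Equiv.apply_symm_apply]

theorem edge_eq (d : (graph t).Dart) :
    d.edge = s((equivDart.symm d).src, (equivDart.symm d).rev.src) := by
  rw [equivDart_symm_src, equivDart_symm_rev_src]
  rfl

/-- The path that replaces a dart, between the images of its ends. -/
noncomputable def dartPath (t : ℕ) (d : (graph 0).Dart) :
    (graph t).Walk (branch t d.fst) (branch t d.snd) :=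
  (path (equivDart.symm d)).2.2.copy
    ((path_start _).trans (congrArg _ (equivDart_symm_src d)))
    ((path_end _).trans (congrArg _ (equivDart_symm_rev_src d)))

theorem support_dartPath (d : (graph 0).Dart) :
    (dartPath t d).support = (path (equivDart.symm d)).2.2.support :=
  SimpleGraph.Walk.support_copy _ _ _

theorem mem_support_dartPath {d : (graph 0).Dart} {w : Option (ZMod 3 × Fin (t + 1))} :
    w ∈ (dartPath t d).support ↔ OnPath (equivDart.symm d) w := by
  rw [support_dartPath, mem_support_path]

theorem dartPath_symm (d : (graph 0).Dart) : dartPath t d.symm = (dartPath t d).reverse := by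
  apply SimpleGraph.Walk.ext_support
  refine Eq.trans ?_ (SimpleGraph.Walk.support_reverse (dartPath t d)).symm
  rw [support_dartPath, support_dartPath, equivDart_symm_symm, support_path_rev]

theorem firstDart_dartPath (d : (graph 0).Dart) (h : ¬ (dartPath t d).Nil) :
    (dartPath t d).firstDart h = equivDart (corner (equivDart.symm d)) := by
  have key : ∀ {u v : Option (ZMod 3 × Fin (t + 1))}
      (hu : (path (equivDart.symm d)).1 = u) (hv : (path (equivDart.symm d)).2.1 = v)
      (h : ¬ ((path (equivDart.symm d)).2.2.copy hu hv).Nil),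
      ((path (equivDart.symm d)).2.2.copy hu hv).firstDart h =
        equivDart (corner (equivDart.symm d)) := by
    rintro _ _ rfl rfl h
    exact SimpleGraph.Walk.firstDart_eq_of_snd_eq h (path_start_eq_src_corner _) (snd_path _)
  exact key _ _ h

theorem branch_mem_dartPath {d : (graph 0).Dart} {x : Option (ZMod 3 × Fin 1)}
    (h : branch t x ∈ (dartPath t d).support) : x = d.fst ∨ x = d.snd := by
  have := eq_src_of_onPath_branch (mem_support_dartPath.1 h)
  rwa [equivDart_symm_src, equivDart_symm_rev_src] at this

theorem dartPath_disjoint {d e : (graph 0).Dart} {w : Option (ZMod 3 × Fin (t + 1))}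
    (hd : w ∈ (dartPath t d).support) (he : w ∈ (dartPath t e).support) (h : d.edge ≠ e.edge) :
    w ∈ Set.range (branch t) := by
  refine mem_range_branch_of_onPath (mem_support_dartPath.1 hd) (mem_support_dartPath.1 he) ?_
  rwa [← edge_eq, ← edge_eq]

theorem exists_mem_support_dartPath (w : Option (ZMod 3 × Fin (t + 1))) :
    w ∈ Set.range (branch t) ∨ ∃ d, w ∈ (dartPath t d).support := by
  rcases w with _ | ⟨i, k⟩
  · exact Or.inl ⟨none, rfl⟩
  · refine Or.inr ⟨equivDart (out i 0), ?_⟩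
    rw [mem_support_dartPath, Equiv.symm_apply_apply]
    exact Or.inr ⟨k, rfl⟩

theorem exists_mem_edges_dartPath {e : Sym2 (Option (ZMod 3 × Fin (t + 1)))}
    (he : e ∈ (graph t).edgeSet) : ∃ d, e ∈ (dartPath t d).edges := by
  obtain ⟨k, rfl⟩ : ∃ k : (graph t).Dart, k.edge = e := by
    induction e with | _ a b => exact ⟨⟨(a, b), he⟩, rfl⟩
  obtain ⟨d, hd⟩ := exists_mem_edges_path (equivDart.symm k)
  refine ⟨equivDart d, ?_⟩
  rw [dartPath, SimpleGraph.Walk.edges_copy, Equiv.symm_apply_apply, edge_eq]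
  exact hd

theorem rot_firstDart_dartPath (d : (graph 0).Dart) (h : ¬ (dartPath t d).Nil)
    (h' : ¬ (dartPath t (equivDart.permCongr rot d)).Nil) :
    equivDart.permCongr rot ((dartPath t d).firstDart h) =
      (dartPath t (equivDart.permCongr rot d)).firstDart h' := by
  rw [firstDart_dartPath, firstDart_dartPath, Equiv.permCongr_apply, Equiv.permCongr_apply,
    Equiv.symm_apply_apply, Equiv.symm_apply_apply, rot_corner]

end SpiderDart

open SpiderDart in
/-- A spider is a subdivision of the spider with legs of one vertex, which is the complete graph on
four vertices. -/
noncomputable def spiderSubdivision (t : ℕ) : PlaneSubdivision (spider 0) (spider t) where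
  branch := branch t
  path := dartPath t
  path_isPath _ := (SimpleGraph.Walk.isPath_copy _ _ _).2 (isPath_path _)
  path_symm := dartPath_symm
  branch_mem_path _ _ := branch_mem_dartPath
  path_disjoint _ _ _ := dartPath_disjoint
  vertex_covered := exists_mem_support_dartPath
  edge_covered _ := exists_mem_edges_dartPath
  rot_firstDart := rot_firstDart_dartPath

/-! ### Parameters of the spiders -/

namespace SpiderDart

variable {t : ℕ}

theorem facePerm_spider (t : ℕ) : (spider t).facePerm = equivDart.permCongr (revPerm.trans rot) :=
  permCongr_facePerm t

/-- The face with a given label. -/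
noncomputable def face (t : ℕ) (l : Option (ZMod 3)) : (spider t).Face :=
  (spider t).faceOf (equivDart (ofLabel l))

theorem faceOf_equivDart (d : SpiderDart t) : (spider t).faceOf (equivDart d) = face t d.label := by
  apply Quotient.sound
  change (spider t).facePerm.SameCycle _ _
  rw [facePerm_spider]
  exact (sameCycle_facePerm d).permCongr _

theorem exists_face_eq (f : (spider t).Face) : ∃ l, face t l = f := by
  obtain ⟨d, rfl⟩ : ∃ d, (spider t).faceOf d = f := Quotient.exists_rep f
  obtain ⟨d, rfl⟩ := equivDart.surjective d
  exact ⟨d.label, (faceOf_equivDart d).symm⟩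

theorem face_injective (t : ℕ) : Function.Injective (face t) := by
  intro l l' h
  have := PlaneGraph.apply_eq_of_faceOf_eq (G := spider t)
    (φ := fun d : (graph t).Dart => (equivDart.symm d).label) (fun d => by
      obtain ⟨d, rfl⟩ := equivDart.surjective d
      refine (congrArg label (equivDart.symm_apply_eq.2 ?_)).trans ((label_rot_rev d).trans
        (congrArg label (equivDart.symm_apply_apply d).symm))
      rw [facePerm_spider]
      exact congrArg (fun x => equivDart (rot x.rev)) (equivDart.symm_apply_apply d)) h
  simpa [label_ofLabel] using this

theorem incident_face {w : Option (ZMod 3 × Fin (t + 1))} {l : Option (ZMod 3)} :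
    PlaneGraph.Incident w (face t l) ↔ ∃ d : SpiderDart t, d.src = w ∧ d.label = l := by
  constructor
  · rintro ⟨d, rfl, h⟩
    obtain ⟨d, rfl⟩ := equivDart.surjective d
    exact ⟨d, rfl, face_injective t ((faceOf_equivDart d).symm.trans h)⟩
  · rintro ⟨d, rfl, rfl⟩
    exact ⟨equivDart d, rfl, faceOf_equivDart d⟩

theorem incident_center (i : ZMod 3) :
    PlaneGraph.Incident (none : Option (ZMod 3 × Fin (t + 1))) (face t (some i)) :=
  incident_face.2 ⟨out (i + 1) 0, rfl, by simp [label]⟩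

theorem incident_right (i : ZMod 3) (k : Fin (t + 1)) :
    PlaneGraph.Incident (some (i, k)) (face t (some i)) :=
  incident_face.2 ⟨inn i k, rfl, rfl⟩

theorem incident_left (i : ZMod 3) (k : Fin (t + 1)) :
    PlaneGraph.Incident (some (i + 1, k)) (face t (some i)) := by
  rw [incident_face]
  cases k using Fin.lastCases with
  | last => exact ⟨cw i, rfl, rfl⟩
  | cast k => exact ⟨out (i + 1) k.succ, rfl, by simp [label]⟩

theorem incident_outer (i : ZMod 3) :
    PlaneGraph.Incident (some (i, Fin.last t)) (face t none) :=
  incident_face.2 ⟨ccw i, rfl, rfl⟩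

theorem add_one_add_one_add_one (i : ZMod 3) : i + 1 + 1 + 1 = i := by
  revert i
  decide

theorem add_one_ne_sub_one (i : ZMod 3) : i + 1 ≠ i - 1 := by
  revert i
  decide

/-- Any two of the three legs bound a common face, and the center lies on it. So every cyclic
coloring is injective. -/
theorem exists_incident (v w : Option (ZMod 3 × Fin (t + 1))) :
    ∃ f : (spider t).Face, PlaneGraph.Incident v f ∧ PlaneGraph.Incident w f := by
  rcases v with _ | ⟨i, k⟩ <;> rcases w with _ | ⟨i', k'⟩
  · exact ⟨_, incident_center 0, incident_center 0⟩
  · exact ⟨_, incident_center i', incident_right i' k'⟩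
  · exact ⟨_, incident_right i k, incident_center i⟩
  · rcases eq_or_eq_add i i' with rfl | rfl | rfl
    · exact ⟨_, incident_right _ _, incident_right _ _⟩
    · exact ⟨_, incident_right _ _, incident_left _ _⟩
    · refine ⟨face t (some (i + 1 + 1)), ?_, incident_right _ _⟩
      have := incident_left (i + 1 + 1) k
      rwa [add_one_add_one_add_one i] at this

theorem card_le_cyclicChromaticNumber (t : ℕ) : 3 * t + 4 ≤ (spider t).cyclicChromaticNumber := by
  obtain ⟨c, hc⟩ := (spider t).exists_isCyclicColoring
  have hinj : Function.Injective c := by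
    intro v w h
    by_contra hne
    obtain ⟨f, hv, hw⟩ := exists_incident v w
    exact hc f v w hv hw hne h
  have := Nat.card_le_card_of_injective c hinj
  simp only [Nat.card_eq_fintype_card, Fintype.card_option, Fintype.card_prod, ZMod.card,
    Fintype.card_fin] at this
  omega

theorem cyclicChromaticNumber_spider_zero_le : (spider 0).cyclicChromaticNumber ≤ 4 := by
  have := PlaneGraph.cyclicChromaticNumber_le (G := spider 0) (c := id)
    fun _ _ _ _ _ h => h
  simpa [Nat.card_eq_fintype_card] using this

theorem three_le_faceDegree (f : (spider t).Face) : 3 ≤ (spider t).faceDegree f := by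
  have key : ∀ a b c : Option (ZMod 3 × Fin (t + 1)), a ≠ b → a ≠ c → b ≠ c →
      PlaneGraph.Incident a f → PlaneGraph.Incident b f → PlaneGraph.Incident c f →
      3 ≤ (spider t).faceDegree f := by
    intro a b c hab hac hbc ha hb hc
    refine (Set.ncard_eq_three.2 ⟨a, b, c, hab, hac, hbc, rfl⟩).symm.trans_le
      (Set.ncard_le_ncard ?_ (Set.toFinite _))
    rintro _ (rfl | rfl | rfl) <;> assumption
  obtain ⟨_ | i, rfl⟩ := exists_face_eq f
  · refine key _ _ _ ?_ ?_ ?_ (incident_outer 0) (incident_outer 1) (incident_outer 2) <;>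
    · simp only [ne_eq, Option.some.injEq, Prod.mk.injEq, and_true]
      decide
  · refine key _ _ _ ?_ ?_ ?_ (incident_center i) (incident_right i 0) (incident_left i 0)
    · simp
    · simp
    · simp

/-- A face between two legs has the center and `2 (t + 1)` vertices of legs; the outer face has only
the three leg ends. -/
theorem faceDegree_le (f : (spider t).Face) : (spider t).faceDegree f ≤ 2 * t + 3 := by
  have hrange : ∀ {ι : Type} [Fintype ι] (g : ι → Option (ZMod 3 × Fin (t + 1))),
      (Set.range g).ncard ≤ Fintype.card ι := by
    intro ι _ g
    have := Set.ncard_image_le (f := g) (s := Set.univ) (Set.toFinite _)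
    rwa [Set.image_univ, Set.ncard_univ, Nat.card_eq_fintype_card] at this
  obtain ⟨_ | i, rfl⟩ := exists_face_eq f
  · have hsub : {w : Option (ZMod 3 × Fin (t + 1)) | PlaneGraph.Incident w (face t none)} ⊆
        Set.range fun i : ZMod 3 => some (i, Fin.last t) := by
      intro w hw
      obtain ⟨d, rfl, hd⟩ := incident_face.1 hw
      cases d with
      | out j l => exact nomatch hd
      | inn j l => exact nomatch hd
      | ccw j => exact ⟨j, rfl⟩
      | cw j => exact nomatch hd
    have := (Set.ncard_le_ncard hsub (Set.toFinite _)).trans (hrange _)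
    rw [ZMod.card] at this
    exact this.trans (by omega)
  · have hsub : {w : Option (ZMod 3 × Fin (t + 1)) | PlaneGraph.Incident w (face t (some i))} ⊆
        {none} ∪ (Set.range fun k => some (i, k)) ∪ Set.range fun k => some (i + 1, k) := by
      intro w hw
      obtain ⟨d, rfl, hd⟩ := incident_face.1 hw
      cases d with
      | out j l =>
        obtain rfl : j = i + 1 := sub_eq_iff_eq_add.1 (Option.some.inj hd)
        cases l using Fin.cases with
        | zero => exact Or.inl (Or.inl rfl)
        | succ k => exact Or.inr ⟨k.castSucc, rfl⟩
      | inn j l =>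
        obtain rfl : j = i := Option.some.inj hd
        exact Or.inl (Or.inr ⟨l, rfl⟩)
      | ccw j => exact nomatch hd
      | cw j =>
        obtain rfl : j = i := Option.some.inj hd
        exact Or.inr ⟨Fin.last t, rfl⟩
    have h1 := Set.ncard_le_ncard hsub (Set.toFinite _)
    have h2 := Set.ncard_union_le
      ({none} ∪ (Set.range fun k => (some (i, k) : Option (ZMod 3 × Fin (t + 1)))))
      (Set.range fun k => some (i + 1, k))
    have h3 := Set.ncard_union_le {none}
      (Set.range fun k => (some (i, k) : Option (ZMod 3 × Fin (t + 1))))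
    have h4 := hrange fun k : Fin (t + 1) => some (i, k)
    have h5 := hrange fun k : Fin (t + 1) => some (i + 1, k)
    rw [Set.ncard_singleton] at h3
    rw [Fintype.card_fin] at h4 h5
    rw [PlaneGraph.faceDegree]
    omega

/-- The center and the ends of the legs have three distinct neighbors. -/
theorem exists_of_ncard_neighborSet_eq_two {w : Option (ZMod 3 × Fin (t + 1))}
    (h : ((graph t).neighborSet w).ncard = 2) : ∃ i, ∃ k : Fin t, w = some (i, k.castSucc) := by
  have key : ∀ a b c : Option (ZMod 3 × Fin (t + 1)), a ≠ b → a ≠ c → b ≠ c →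
      (graph t).Adj w a → (graph t).Adj w b → ¬ (graph t).Adj w c := by
    intro a b c hab hac hbc ha hb hc
    have : ({a, b, c} : Set _).ncard ≤ ((graph t).neighborSet w).ncard := by
      refine Set.ncard_le_ncard ?_ (Set.toFinite _)
      rintro _ (rfl | rfl | rfl) <;> assumption
    rw [Set.ncard_eq_three.2 ⟨a, b, c, hab, hac, hbc, rfl⟩] at this
    omega
  rcases w with _ | ⟨i, k⟩
  · refine absurd (adj (out 2 0)) (key _ _ _ ?_ ?_ ?_ (adj (out 0 0)) (adj (out 1 0))) <;>
    · simp only [src, rev, ne_eq, Option.some.injEq, Prod.mk.injEq, and_true]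
      decide
  · cases k using Fin.lastCases with
    | cast k => exact ⟨i, k, rfl⟩
    | last =>
      have hcw := adj (t := t) (cw (i - 1))
      rw [show (cw (i - 1) : SpiderDart t).src = some (i, Fin.last t) by simp [src]] at hcw
      refine absurd hcw (key _ _ _ ?_ ?_ ?_ (adj (inn i (Fin.last t))) (adj (ccw i)))
      · exact inner_ne_last _ _ _
      · exact inner_ne_last _ _ _
      · simp only [src, rev, ne_eq, Option.some.injEq, Prod.mk.injEq, and_true]
        exact add_one_ne_sub_one i

theorem eq_of_adj {i i' : ZMod 3} {k k' : Fin t}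
    (h : (graph t).Adj (some (i, k.castSucc)) (some (i', k'.castSucc))) : i = i' := by
  have hne : ∀ (k : Fin t), k.castSucc ≠ Fin.last t := fun k => (Fin.castSucc_lt_last k).ne
  obtain ⟨d, h, h'⟩ := h
  cases d with
  | out j l =>
    have h1 := (inner_eq_some.1 h).1
    have h2 : j = i' := congrArg Prod.fst (Option.some.inj h')
    exact h1.symm.trans h2
  | inn j l =>
    have h1 := (inner_eq_some.1 h').1
    have h2 : j = i := congrArg Prod.fst (Option.some.inj h)
    exact h2.symm.trans h1
  | ccw j => exact absurd (congrArg Prod.snd (Option.some.inj h)).symm (hne k)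
  | cw j => exact absurd (congrArg Prod.snd (Option.some.inj h)).symm (hne k)

/-- A path of degree-2 vertices cannot change legs, and each leg has `t` such vertices. The reverse
inequality is not proved directly: it falls out of the upper bound on the cyclic chromatic number.
-/
theorem longestTwoPath_le (t : ℕ) : (spider t).longestTwoPath ≤ t := by
  classical
  refine csSup_le' ?_
  rintro _ ⟨x, y, p, hp, h, rfl⟩
  replace h : ∀ w ∈ p.support, ∃ i, ∃ k : Fin t, w = some (i, k.castSucc) :=
    fun w hw => exists_of_ncard_neighborSet_eq_two (h w hw)
  obtain ⟨i, k, rfl⟩ := h x p.start_mem_support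
  have hleg : ∀ w ∈ p.support, ∃ k : Fin t, w = some (i, k.castSucc) := by
    clear hp
    generalize hx : (some (i, k.castSucc) : Option (ZMod 3 × Fin (t + 1))) = x at p
    induction p generalizing k with
    | nil =>
      intro w hw
      rw [SimpleGraph.Walk.support_nil, List.mem_singleton] at hw
      exact ⟨k, hw.trans hx.symm⟩
    | @cons a b c hab p ih =>
      intro w hw
      rw [SimpleGraph.Walk.support_cons, List.mem_cons] at hw
      rcases hw with rfl | hw
      · exact ⟨k, hx.symm⟩
      · obtain ⟨i', k', rfl⟩ := h b (by simp)
        rw [← hx] at hab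
        obtain rfl := eq_of_adj hab
        exact ih k' rfl (fun w hw => h w (List.mem_cons_of_mem _ hw)) w hw
  rw [← List.toFinset_card_of_nodup ((SimpleGraph.Walk.isPath_def _).1 hp)]
  have hsub : p.support.toFinset ⊆
      Finset.univ.image fun k : Fin t => (some (i, k.castSucc) : Option (ZMod 3 × Fin (t + 1))) := by
    intro w hw
    obtain ⟨k, rfl⟩ := hleg w (List.mem_toFinset.1 hw)
    simp
  refine (Finset.card_le_card hsub).trans (Finset.card_image_le.trans ?_)
  simp

/-- The graph is complete on four vertices, so whatever remains after deleting fewer than three is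
nonempty and complete. -/
theorem isThreeConnected_spider_zero : (spider 0).IsThreeConnected := by
  have hadj : ∀ v w : Option (ZMod 3 × Fin 1), v ≠ w → (graph 0).Adj v w := by
    have hc : ∀ (i : ZMod 3) (k : Fin 1), (graph 0).Adj none (some (i, k)) := by
      intro i k
      rw [Subsingleton.elim k 0]
      exact adj (out i 0)
    have hr : ∀ (i : ZMod 3) (k l : Fin 1), (graph 0).Adj (some (i, k)) (some (i + 1, l)) := by
      intro i k l
      rw [Subsingleton.elim k (Fin.last 0), Subsingleton.elim l (Fin.last 0)]
      exact adj (ccw i)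
    rintro (_ | ⟨i, k⟩) (_ | ⟨i', k'⟩) h
    · exact absurd rfl h
    · exact hc _ _
    · exact (hc _ _).symm
    · rcases eq_or_eq_add i i' with rfl | rfl | rfl
      · exact absurd (by rw [Subsingleton.elim k k']) h
      · exact hr _ _ _
      · have := hr (i + 1 + 1) k' k
        rw [add_one_add_one_add_one i] at this
        exact this.symm
  have hcard : Nat.card (Option (ZMod 3 × Fin (0 + 1))) = 4 := by simp [Nat.card_eq_fintype_card]
  refine ⟨by omega, fun S hS => ?_⟩
  have hne : Nonempty (Sᶜ : Set (Option (ZMod 3 × Fin 1))) := by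
    rw [Set.nonempty_coe_sort, Set.nonempty_compl]
    rintro rfl
    rw [Set.ncard_univ] at hS
    omega
  refine ⟨fun v w => ?_⟩
  by_cases h : v = w
  · rw [h]
  · exact SimpleGraph.Adj.reachable (hadj v.1 w.1 fun h' => h (Subtype.ext h'))

end SpiderDart

/-! ### The theorem -/

theorem theorem8 :
    (∀ (V : Type u) (W : Type v) [Finite V] [Finite W] (R : PlaneGraph V) (G : PlaneGraph W)
      (S : PlaneSubdivision R G), R.IsThreeConnected →
        (G.cyclicChromaticNumber : ℤ)
          ≤ S.maxExcess + G.longestTwoPath + R.cyclicChromaticNumber) ∧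
    (∀ t : ℕ, ∃ (V W : Type) (_ : Finite V) (_ : Finite W) (R : PlaneGraph V) (G : PlaneGraph W)
      (S : PlaneSubdivision R G), R.IsThreeConnected ∧ G.longestTwoPath = t ∧
        (G.cyclicChromaticNumber : ℤ)
          = S.maxExcess + G.longestTwoPath + R.cyclicChromaticNumber) := by
  refine ⟨fun V W _ _ R G S h3 => S.cyclicChromaticNumber_le h3, fun t => ?_⟩
  have h3 := SpiderDart.isThreeConnected_spider_zero
  have hexcess : (spiderSubdivision t).maxExcess ≤ 2 * t := by
    have : Nonempty (spider t).Face := ⟨SpiderDart.face t none⟩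
    refine ciSup_le fun f => ?_
    have h1 := SpiderDart.faceDegree_le f
    have h2 := SpiderDart.three_le_faceDegree ((spiderSubdivision t).origFace f)
    omega
  -- The general bound closes a circle: `3t + 4 ≤ χ_c(G) ≤ maxExcess + t(G) + χ_c(R) ≤ 2t + t + 4`.
  -- Hence equality holds throughout, including `t(G) = t`.
  have hbound := (spiderSubdivision t).cyclicChromaticNumber_le h3
  have hpath := SpiderDart.longestTwoPath_le t
  have hR := SpiderDart.cyclicChromaticNumber_spider_zero_le
  have hG := SpiderDart.card_le_cyclicChromaticNumber t
  have htwo : (spider t).longestTwoPath = t := by omega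
  refine ⟨_, _, inferInstance, inferInstance, spider 0, spider t, spiderSubdivision t, h3, htwo, ?_⟩
  have hGle := PlaneGraph.cyclicChromaticNumber_le (G := spider t) (c := id) fun _ _ _ _ _ h => h
  simp only [Nat.card_eq_fintype_card, Fintype.card_option, Fintype.card_prod, ZMod.card,
    Fintype.card_fin] at hGle
  omega
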